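/- Let $(\Omega,\mathcal F,\mathbb P)$ be a probability space and let $\{X_n\}_{n=1}^\infty$ be i.i.d. real random variables on it which are almost surely nonnegative and (essentially) bounded. Let $\mathcal H$ be a complex Hilbert space with orthonormal basis $\{e_n\}_{n=1}^\infty$, and let $T=T(\omega)$ be the random weighted shift on $\mathcal H$, i.e. for almost every $\omega$ the bounded operator with $T(\omega)e_n=X_n(\omega)e_{n+1}$ for all $n\ge 1$; $T^*$ is its adjoint. Write $\operatorname{ess\,ran}X_1=\{t\in\mathbb R:\ \mathbb P(|X_1-t|<\varepsilon)>0 \text{ for all }\varepsilon>0\}$ and $R=\max\operatorname{ess\,ran}X_1$. Assume that $\operatorname{ess\,ran}X_1$ contains more than one point and that $\mathbb P(X_1=0)=0$. The expectation $\mathbb E(\ln X_1)\in[-\infty,\infty)$ is understood as $\mathbb E((\ln X_1)^+)-\mathbb E((\ln X_1)^-)$. Then: 1. $T^*$ is almost surely supercyclic. 2. $\mathbb P(T^*\text{ is hypercyclic})=1$ if $\mathbb E(\ln X_1)\ge 0$, and $=0$ if $\mathbb E(\ln X_1)<0$. 3. $\mathbb P(T^*\text{ is Li–Yorke chaotic})=1$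 if $R>1$, and $=0$ if $R\le 1$. 4. $\mathbb P(T^*\text{ is topologically mixing})=1$ if $\mathbb E(\ln X_1)>0$, and $=0$ if $\mathbb E(\ln X_1)\le 0$. 5. $\mathbb P(T^*\text{ is chaotic})=\mathbb P(T^*\text{ is frequently hypercyclic})=1$ if $\mathbb E(\ln X_1)>0$, and both are $=0$ if $\mathbb E(\ln X_1)\le 0$. Here a bounded operator $A$ on $\mathcal H$ is called - *supercyclic* if $\{\lambda A^nx:\lambda\in\mathbb C,\ n\ge 0\}$ is dense for some $x\in\mathcal H$, and *hypercyclic* if $\{A^nx:n\ge 0\}$ is dense for some $x\in\mathcal H$; - *Li–Yorke chaotic* if there is an uncountable $G\subset\mathcal H$ such that $\limsup_{n\to\infty}\|A^n(x-y)\|>0$ and $\liminf_{n\to\infty}\|A^n(x-y)\|=0$ for all distinct $x,y\in G$; - *topologically mixing* if for all nonempty open $G_1,G_2\subset\mathcal H$ there is $n\ge 1$ with $A^m(G_1)\cap G_2\neq\emptyset$ for every $m\ge n$; - *chaotic* if (a) for all nonempty open $G_1,G_2$ there is $n\ge 1$ with $A^n(G_1)\cap G_2\ne\emptyset$, (b)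 the set of $x$ with $A^kx=x$ for some $k\ge 1$ is dense, and (c) there is $\delta>0$ such that for every $x\in\mathcal H$ and every neighborhood $G$ of $x$ there are $y\in G$ and $n\ge 0$ with $\|A^nx-A^ny\|\ge\delta$; - *frequently hypercyclic* if there is $x\in\mathcal H$ such that for every nonempty open $G\subset\mathcal H$ the set $\Lambda=\{k\ge 1:A^kx\in G\}$ has positive lower density, i.e. $\liminf_{n\to\infty}\frac1n\operatorname{card}(\Lambda\cap[1,n])>0$. -/

import Mathlib

open MeasureTheory ProbabilityTheory Filter Topology Set
open scoped ENNReal lp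

noncomputable section

namespace RandomShift

/-! ### Weighted shifts -/

section Shift

variable {H : Type*} [NormedAddCommGroup H] [InnerProductSpace ℂ H] [CompleteSpace H]

open scoped Classical in
/-- The unilateral weighted shift `e n ↦ w n • e (n + 1)` with respect to the orthonormal basis
`e` of `H`, where `w` is a bounded sequence of real weights (see `weightedShift_apply_basis`).
For unbounded `w`, when no bounded operator acts in this way, the value is `0`.

The coordinate sequence of a vector is multiplied by the weights, and the resulting sequence `x`
is then sent to `∑ x n • e (n + 1)`. -/
def weightedShift (e : HilbertBasis ℕ ℂ H) (w : ℕ → ℝ) : H →L[ℂ] H :=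
  if h : ∃ C : ℝ, ∀ n, |w n| ≤ C then
    ((e.orthonormal.comp (fun n : ℕ => n + 1)
        (add_left_injective 1)).orthogonalFamily.linearIsometry.toContinuousLinearMap) ∘L
      (lp.mapCLM 2 (fun n : ℕ => (w n : ℂ) • ContinuousLinearMap.id ℂ ℂ) (K := h.choose)
        ((abs_nonneg (w 0)).trans (h.choose_spec 0))
        (fun n => by simpa [norm_smul] using h.choose_spec n)) ∘L
      (e.repr.toContinuousLinearEquiv : H →L[ℂ] ℓ²(ℕ, ℂ))
  else 0

/-- The defining property of the weighted shift with bounded weights. -/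
theorem weightedShift_apply_basis (e : HilbertBasis ℕ ℂ H) {w : ℕ → ℝ}
    (hw : ∃ C : ℝ, ∀ n, |w n| ≤ C) (n : ℕ) :
    weightedShift e w (e n) = (w n : ℂ) • e (n + 1) := by
  classical
  rw [weightedShift, dif_pos hw]
  have key : ∀ (K : ℝ) (hK : 0 ≤ K)
      (hT : ∀ i : ℕ, ‖(w i : ℂ) • ContinuousLinearMap.id ℂ ℂ‖ ≤ K),
      lp.mapCLM 2 (fun i : ℕ => (w i : ℂ) • ContinuousLinearMap.id ℂ ℂ) hK hT
        (lp.single 2 n (1 : ℂ)) = lp.single 2 n (w n : ℂ) := by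
    intro K hK hT
    ext i
    by_cases hi : i = n
    · subst hi
      simp
    · simp [hi]
  simp only [ContinuousLinearMap.comp_apply, LinearIsometry.coe_toContinuousLinearMap]
  have hrepr : (e.repr.toContinuousLinearEquiv : H →L[ℂ] ℓ²(ℕ, ℂ)) (e n)
      = lp.single 2 n (1 : ℂ) := e.repr_self n
  rw [hrepr, key, OrthogonalFamily.linearIsometry_apply_single]
  simp

/-- The random weighted shift `T ω`, with weights `X 0 ω, X 1 ω, …`. -/
def randomShift {Ω : Type*} (e : HilbertBasis ℕ ℂ H) (X : ℕ → Ω → ℝ) (ω : Ω) : H →L[ℂ] H :=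
  weightedShift e (fun n => X n ω)

end Shift

/-! ### Random variables -/

section Probability

variable {Ω : Type*} [MeasurableSpace Ω]

/-- The essential range of a real random variable. -/
def essRange (Y : Ω → ℝ) (μ : Measure Ω) : Set ℝ :=
  {t | ∀ ε : ℝ, 0 < ε → 0 < μ {ω | |Y ω - t| < ε}}

/-- `max essRange Y`: for a bounded random variable on a probability space the supremum is
attained. -/
def essMax (Y : Ω → ℝ) (μ : Measure Ω) : ℝ := sSup (essRange Y μ)

/-- The expectation `E(Y⁺) - E(Y⁻)` with values in `[-∞, ∞]`; it is meaningful as soon as one of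
the two terms is finite. -/
def eExpectation (Y : Ω → ℝ) (μ : Measure Ω) : EReal :=
  ((∫⁻ ω, ENNReal.ofReal (Y ω) ∂μ : ℝ≥0∞) : EReal)
    - ((∫⁻ ω, ENNReal.ofReal (-Y ω) ∂μ : ℝ≥0∞) : EReal)

theorem isGreatest_essMax {Y : Ω → ℝ} {μ : Measure Ω} (hne : (essRange Y μ).Nonempty)
    (hbdd : ∃ C : ℝ, ∀ᵐ ω ∂μ, Y ω ≤ C) : IsGreatest (essRange Y μ) (essMax Y μ) := by
  have hB : BddAbove (essRange Y μ) := by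
    obtain ⟨C, hC⟩ := hbdd
    refine ⟨C, fun t ht => ?_⟩
    by_contra! hlt
    refine (ht (t - C) (by linarith)).ne' (measure_mono_null (fun ω hω => ?_) hC)
    have hω' : |Y ω - t| < t - C := hω
    have := (abs_lt.mp hω').1
    simp only [mem_compl_iff, mem_ofPred_eq, not_le]
    linarith
  refine ⟨fun ε hε => ?_, fun t ht => le_csSup hB ht⟩
  obtain ⟨t, ht, hlt⟩ := exists_lt_of_lt_csSup hne
    (show essMax Y μ - ε / 2 < sSup (essRange Y μ) by unfold essMax; linarith)
  have hle : t ≤ essMax Y μ := le_csSup hB ht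
  refine (ht (ε / 2) (by linarith)).trans_le (measure_mono fun ω hω => ?_)
  have hω' : |Y ω - t| < ε / 2 := hω
  have h := abs_lt.mp hω'
  show |Y ω - essMax Y μ| < ε
  exact abs_lt.mpr ⟨by linarith [h.1], by linarith [h.2]⟩

theorem eExpectation_eq_integral {Y : Ω → ℝ} {μ : Measure Ω} (hY : Integrable Y μ) :
    eExpectation Y μ = ((∫ ω, Y ω ∂μ : ℝ) : EReal) := by
  have h1 := hY.lintegral_lt_top
  have h2 : ∫⁻ ω, ENNReal.ofReal (-Y ω) ∂μ < ∞ := hY.neg.lintegral_lt_top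
  rw [integral_eq_lintegral_pos_part_sub_lintegral_neg_part hY, EReal.coe_sub,
    EReal.coe_ennreal_toReal h1.ne, EReal.coe_ennreal_toReal h2.ne, eExpectation]

end Probability

/-! ### Linear dynamics -/

section Dynamics

variable {H : Type*} [NormedAddCommGroup H] [InnerProductSpace ℂ H]

/-- Some projective orbit `{c • A ^ n x : c ∈ ℂ, n ≥ 0}` is dense. -/
def IsSupercyclic (A : H →L[ℂ] H) : Prop :=
  ∃ x : H, Dense {y : H | ∃ (c : ℂ) (n : ℕ), y = c • (A ^ n) x}

/-- Some orbit `{A ^ n x : n ≥ 0}` is dense. -/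
def IsHypercyclic (A : H →L[ℂ] H) : Prop :=
  ∃ x : H, Dense {y : H | ∃ n : ℕ, y = (A ^ n) x}

/-- `{x, y}` is a Li–Yorke chaotic pair for `A`. The limits are taken in `[0, ∞]`, so that the
upper limit is `∞` if the sequence is unbounded. -/
def IsLiYorkePair (A : H →L[ℂ] H) (x y : H) : Prop :=
  0 < limsup (fun n : ℕ => ‖(A ^ n) (x - y)‖ₑ) atTop ∧
    liminf (fun n : ℕ => ‖(A ^ n) (x - y)‖ₑ) atTop = 0

def IsLiYorkeChaotic (A : H →L[ℂ] H) : Prop :=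
  ∃ G : Set H, ¬ G.Countable ∧ ∀ x ∈ G, ∀ y ∈ G, x ≠ y → IsLiYorkePair A x y

/-- Sensitive dependence on initial conditions. -/
def IsSensitive (A : H →L[ℂ] H) : Prop :=
  ∃ δ : ℝ, 0 < δ ∧ ∀ x : H, ∀ G ∈ 𝓝 x, ∃ y ∈ G, ∃ n : ℕ, δ ≤ ‖(A ^ n) x - (A ^ n) y‖

def IsTopologicallyMixing (A : H →L[ℂ] H) : Prop :=
  ∀ G₁ G₂ : Set H, IsOpen G₁ → G₁.Nonempty → IsOpen G₂ → G₂.Nonempty →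
    ∃ n : ℕ, 1 ≤ n ∧ ∀ m : ℕ, n ≤ m → ((fun x => (A ^ m) x) '' G₁ ∩ G₂).Nonempty

def IsTopologicallyTransitive (A : H →L[ℂ] H) : Prop :=
  ∀ G₁ G₂ : Set H, IsOpen G₁ → G₁.Nonempty → IsOpen G₂ → G₂.Nonempty →
    ∃ n : ℕ, 1 ≤ n ∧ ((fun x => (A ^ n) x) '' G₁ ∩ G₂).Nonempty

/-- Chaotic in the sense of Devaney. -/
def IsChaotic (A : H →L[ℂ] H) : Prop :=
  IsTopologicallyTransitive A ∧
    Dense {x : H | ∃ k : ℕ, 1 ≤ k ∧ (A ^ k) x = x} ∧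
    IsSensitive A

/-- The lower density of a set of positive integers. -/
def lowerDensity (S : Set ℕ) : ℝ :=
  liminf (fun n : ℕ => ((S ∩ Set.Icc 1 n).ncard : ℝ) / n) atTop

def IsFrequentlyHypercyclic (A : H →L[ℂ] H) : Prop :=
  ∃ x : H, ∀ G : Set H, IsOpen G → G.Nonempty → 0 < lowerDensity {k : ℕ | (A ^ k) x ∈ G}

end Dynamics

end RandomShift

end

open RandomShift

noncomputable section

namespace RandomShift

/-! ### Backward weighted shifts in coordinates. -/

section Operator

variable {H : Type*} [NormedAddCommGroup H] [InnerProductSpace ℂ H]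

/-! The adjoint of the shift is the backward shift with weights `X n ω`, and its dynamics are
governed by the products `P_n = weightProd w n`. These are exponentials of the random walk `S_n`
with i.i.d. steps `Real.log (X n)`.

For fixed positive bounded weights, `B` is always supercyclic; it is hypercyclic iff `P_n` is
unbounded and mixing iff `P_n → ∞`. Exponential growth of `P_n` yields chaos and frequent
hypercyclicity (`IsBackwardShift.isChaotic`, `IsBackwardShift.isFrequentlyHypercyclic`), and each of
these two properties forces `P_n → ∞`. There is a gap between exponential growth and divergence, but
almost no path of the walk falls into it. Positive results use right inverses of `B ^ m` on finitely
supported vectors, which are small where `P` is large; negative ones read off the zeroth coordinate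
`P_m x_m` of `B ^ m x`. The hardest is `IsBackwardShift.not_isFrequentlyHypercyclic`, a correlation
argument for return times.

For the walk, a positive mean gives exponential growth of `P_n` by the strong law, and a negative
mean, possibly `-∞`, gives boundedness. In the centred case `S_n` is unbounded above by martingale
convergence (`ae_not_bddAbove`) but does not tend to infinity (`ae_not_tendsto_atTop`), so
hypercyclicity holds and the stronger properties fail.

Li–Yorke chaos depends only on the essential maximum: if it is at most `1` the operator is a
contraction, otherwise arbitrarily long runs of weights above some `r > 1` occur almost surely and
the powers are unbounded in norm. -/

/-- `B` acts as the backward shift with weights `w`, in the coordinates given by `e`. -/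
def IsBackwardShift (e : HilbertBasis ℕ ℂ H) (w : ℕ → ℝ) (B : H →L[ℂ] H) : Prop :=
  ∀ (x : H) (n : ℕ), e.repr (B x) n = (w n : ℂ) * e.repr x (n + 1)

theorem isBackwardShift_adjoint [CompleteSpace H] (e : HilbertBasis ℕ ℂ H) {w : ℕ → ℝ}
    (hw : ∃ C : ℝ, ∀ n, |w n| ≤ C) :
    IsBackwardShift e w (ContinuousLinearMap.adjoint (weightedShift e w)) := by
  intro x n
  rw [e.repr_apply_apply, ContinuousLinearMap.adjoint_inner_right,
    weightedShift_apply_basis e hw, inner_smul_left, e.repr_apply_apply]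
  simp

/-- The product of the first `n` weights. -/
def weightProd (w : ℕ → ℝ) (n : ℕ) : ℝ := ∏ i ∈ Finset.range n, w i

theorem weightProd_succ (w : ℕ → ℝ) (n : ℕ) :
    weightProd w (n + 1) = weightProd w n * w n := Finset.prod_range_succ _ _

theorem weightProd_pos {w : ℕ → ℝ} (hw : ∀ n, 0 < w n) (n : ℕ) : 0 < weightProd w n :=
  Finset.prod_pos fun i _ => hw i

theorem weightProd_add_le {w : ℕ → ℝ} (hw : ∀ n, 0 < w n) {C : ℝ} (hC : ∀ n, w n ≤ C)
    (n k : ℕ) : weightProd w (n + k) ≤ C ^ k * weightProd w n := by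
  induction k with
  | zero => simp
  | succ k ih =>
    rw [← add_assoc, weightProd_succ, pow_succ]
    have h0 := weightProd_pos hw n
    have hC0 : 0 ≤ C := (hw 0).le.trans (hC 0)
    calc weightProd w (n + k) * w (n + k) ≤ (C ^ k * weightProd w n) * C :=
          mul_le_mul ih (hC _) (hw _).le (by positivity)
      _ = _ := by ring

theorem ext_repr (e : HilbertBasis ℕ ℂ H) {x y : H} (h : ∀ n, e.repr x n = e.repr y n) :
    x = y :=
  e.repr.injective (lp.ext (funext h))

theorem repr_smul_apply (e : HilbertBasis ℕ ℂ H) (c : ℂ) (x : H) (n : ℕ) :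
    e.repr (c • x) n = c * e.repr x n := by
  rw [e.repr_apply_apply, inner_smul_right, ← e.repr_apply_apply]

theorem repr_basis_self (e : HilbertBasis ℕ ℂ H) (k : ℕ) : e.repr (e k) k = 1 := by
  simp [e.repr_self]

theorem repr_basis_of_ne (e : HilbertBasis ℕ ℂ H) {n k : ℕ} (h : n ≠ k) :
    e.repr (e k) n = 0 := by
  simp [e.repr_self, h]

variable {e : HilbertBasis ℕ ℂ H} {w : ℕ → ℝ} {B : H →L[ℂ] H}

namespace IsBackwardShift

/-- Keeping `weightProd w n` on the left avoids a division, so no positivity of the weights is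
needed. -/
theorem repr_pow (hB : IsBackwardShift e w B) (m n : ℕ) (x : H) :
    (weightProd w n : ℂ) * e.repr ((B ^ m) x) n
      = (weightProd w (n + m) : ℂ) * e.repr x (n + m) := by
  induction m generalizing x with
  | zero => simp
  | succ m ih =>
    rw [pow_succ, mul_apply_eq_comp, ih, hB, ← add_assoc, weightProd_succ]
    push_cast; ring

/-- All negative results except the one on Li–Yorke chaos come from this coordinate. -/
theorem repr_pow_zero (hB : IsBackwardShift e w B) (m : ℕ) (x : H) :
    e.repr ((B ^ m) x) 0 = (weightProd w m : ℂ) * e.repr x m := by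
  simpa [weightProd] using hB.repr_pow m 0 x

theorem apply_zero (hB : IsBackwardShift e w B) : B (e 0) = 0 := by
  refine ext_repr e fun n => ?_
  rw [hB, repr_basis_of_ne e (Nat.succ_ne_zero n)]
  simp

theorem apply_succ (hB : IsBackwardShift e w B) (k : ℕ) : B (e (k + 1)) = (w k : ℂ) • e k := by
  refine ext_repr e fun n => ?_
  rw [hB, repr_smul_apply]
  by_cases h : n = k
  · subst h; rw [repr_basis_self, repr_basis_self]
  · rw [repr_basis_of_ne e h, repr_basis_of_ne e (by omega), mul_zero, mul_zero]

theorem pow_apply_eq_zero (hB : IsBackwardShift e w B) {m k : ℕ} (h : k < m) :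
    (B ^ m) (e k) = 0 := by
  induction k generalizing m with
  | zero =>
    obtain ⟨m, rfl⟩ := Nat.exists_eq_succ_of_ne_zero h.ne'
    rw [pow_succ, mul_apply_eq_comp, hB.apply_zero, map_zero]
  | succ k ih =>
    obtain ⟨m, rfl⟩ := Nat.exists_eq_succ_of_ne_zero (Nat.ne_zero_of_lt h)
    rw [pow_succ, mul_apply_eq_comp, hB.apply_succ, map_smul, ih (by omega), smul_zero]

end IsBackwardShift

theorem norm_repr_le (e : HilbertBasis ℕ ℂ H) (x : H) (n : ℕ) : ‖e.repr x n‖ ≤ ‖x‖ := by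
  rw [← e.repr.norm_map x]
  exact lp.norm_apply_le_norm (by norm_num) _ _

theorem continuous_repr_apply (e : HilbertBasis ℕ ℂ H) (n : ℕ) :
    Continuous fun x : H => e.repr x n := by
  simp only [e.repr_apply_apply]
  fun_prop

/-- The right inverse of the `m`-th power of the backward shift on finitely supported vectors. -/
def fwd (e : HilbertBasis ℕ ℂ H) (w : ℕ → ℝ) (m : ℕ) : (ℕ →₀ ℂ) →ₗ[ℂ] H :=
  Finsupp.linearCombination ℂ
    fun k => ((weightProd w k / weightProd w (k + m) : ℝ) : ℂ) • e (k + m)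

theorem fwd_single (e : HilbertBasis ℕ ℂ H) (w : ℕ → ℝ) (m k : ℕ) (c : ℂ) :
    fwd e w m (Finsupp.single k c)
      = c • ((weightProd w k / weightProd w (k + m) : ℝ) : ℂ) • e (k + m) := by
  simp [fwd]

/-- For `m = 0` the weight ratios are `1`, so `fwd e w 0` is the plain embedding of finitely
supported vectors. -/
theorem denseRange_fwd_zero (e : HilbertBasis ℕ ℂ H) (hw : ∀ n, 0 < w n) :
    DenseRange (fwd e w 0) := by
  have h : (fun k => ((weightProd w k / weightProd w (k + 0) : ℝ) : ℂ) • e (k + 0)) = e := by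
    funext k
    simp [div_self (weightProd_pos hw k).ne']
  have h2 : Set.range (fwd e w 0) = (Submodule.span ℂ (Set.range e) : Set H) := by
    rw [← Finsupp.range_linearCombination, fwd, h]; rfl
  rw [DenseRange, h2, Submodule.dense_iff_topologicalClosure_eq_top]
  exact e.dense_span

namespace IsBackwardShift

theorem pow_fwd (hB : IsBackwardShift e w B) (hw : ∀ n, 0 < w n) (m r : ℕ) (a : ℕ →₀ ℂ) :
    (B ^ m) (fwd e w (m + r) a) = fwd e w r a := by
  induction a using Finsupp.induction_linear with
  | zero => simp
  | add f g hf hg => rw [map_add, map_add, map_add, hf, hg]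
  | single k c =>
    rw [fwd_single, fwd_single, map_smul, map_smul]
    congr 1
    have h0 : ∀ n, (weightProd w n : ℂ) ≠ 0 := fun n => by
      exact_mod_cast (weightProd_pos hw n).ne'
    refine ext_repr e fun n => mul_left_cancel₀ (h0 n) ?_
    rw [repr_smul_apply, repr_smul_apply, mul_left_comm, hB.repr_pow m n]
    by_cases h : n = k + r
    · subst h
      have h1 : k + r + m = k + (m + r) := by ring
      have h2 := h0 (k + (m + r))
      have h3 := h0 (k + r)
      rw [h1, repr_basis_self, repr_basis_self]
      push_cast
      field_simp
    · rw [repr_basis_of_ne e h, repr_basis_of_ne e (by omega)]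
      simp

theorem exists_pow_fwd_eq_zero (hB : IsBackwardShift e w B) (a : ℕ →₀ ℂ) :
    ∃ N : ℕ, ∀ s, N ≤ s → (B ^ s) (fwd e w 0 a) = 0 := by
  induction a using Finsupp.induction_linear with
  | zero => exact ⟨0, by simp⟩
  | add f g hf hg =>
    obtain ⟨N, hN⟩ := hf
    obtain ⟨M, hM⟩ := hg
    exact ⟨max N M, fun s hs => by
      rw [map_add, map_add, hN s (le_of_max_le_left hs), hM s (le_of_max_le_right hs), add_zero]⟩
  | single k c =>
    refine ⟨k + 1, fun s hs => ?_⟩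
    rw [fwd_single, map_smul, map_smul, add_zero, hB.pow_apply_eq_zero (by omega), smul_zero,
      smul_zero]

end IsBackwardShift

theorem norm_fwd_single_le (hw : ∀ n, 0 < w n) (m k : ℕ) (c : ℂ) :
    ‖fwd e w m (Finsupp.single k c)‖ = ‖c‖ * (weightProd w k / weightProd w (k + m)) := by
  rw [fwd_single, norm_smul, norm_smul, e.orthonormal.1, mul_one, Complex.norm_real,
    Real.norm_of_nonneg (div_pos (weightProd_pos hw _) (weightProd_pos hw _)).le]

theorem tendsto_fwd {ι : Type*} {l : Filter ι} {m : ι → ℕ} (hw : ∀ n, 0 < w n)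
    (h : ∀ k, Tendsto (fun i => weightProd w (k + m i)) l atTop) (a : ℕ →₀ ℂ) :
    Tendsto (fun i => fwd e w (m i) a) l (𝓝 0) := by
  induction a using Finsupp.induction_linear with
  | zero => simp [tendsto_const_nhds]
  | add f g hf hg => simpa using hf.add hg
  | single k c =>
    rw [tendsto_zero_iff_norm_tendsto_zero]
    simp only [norm_fwd_single_le hw]
    simpa using ((h k).const_div_atTop (weightProd w k)).const_mul ‖c‖

/-- The right inverses decay geometrically, with a constant that depends on the vector. -/
theorem exists_norm_fwd_le (hw : ∀ n, 0 < w n) {c ρ : ℝ} (hc : 0 < c) (hρ : 0 < ρ)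
    (h : ∀ n, c * (ρ⁻¹) ^ n ≤ weightProd w n) (a : ℕ →₀ ℂ) :
    ∃ M : ℝ, ∀ m, ‖fwd e w m a‖ ≤ M * ρ ^ m := by
  induction a using Finsupp.induction_linear with
  | zero => exact ⟨0, by simp⟩
  | add f g hf hg =>
    obtain ⟨N, hN⟩ := hf
    obtain ⟨M, hM⟩ := hg
    refine ⟨N + M, fun m => ?_⟩
    rw [map_add, add_mul]
    exact (norm_add_le _ _).trans (add_le_add (hN m) (hM m))
  | single k b =>
    refine ⟨‖b‖ * weightProd w k * c⁻¹ * ρ ^ k, fun m => ?_⟩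
    rw [norm_fwd_single_le hw, div_eq_mul_inv]
    have h1 : (weightProd w (k + m))⁻¹ ≤ c⁻¹ * ρ ^ (k + m) := by
      calc (weightProd w (k + m))⁻¹ ≤ (c * (ρ⁻¹) ^ (k + m))⁻¹ :=
            inv_anti₀ (by positivity) (h _)
        _ = _ := by rw [mul_inv, inv_pow, inv_inv]
    have h2 := (weightProd_pos hw k).le
    calc ‖b‖ * (weightProd w k * (weightProd w (k + m))⁻¹)
        ≤ ‖b‖ * (weightProd w k * (c⁻¹ * ρ ^ (k + m))) := by gcongr
      _ = _ := by rw [pow_add]; ring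

theorem separableSpace_of_hilbertBasis (e : HilbertBasis ℕ ℂ H) :
    TopologicalSpace.SeparableSpace H := by
  rw [← TopologicalSpace.isSeparable_univ_iff]
  have h := ((Set.countable_range e).isSeparable.span (R := ℂ)).closure
  have h2 : closure (Submodule.span ℂ (Set.range e) : Set H) = univ := by
    rw [← Submodule.topologicalClosure_coe, e.dense_span]; rfl
  rwa [h2] at h

end Operator

/-- Birkhoff's transitivity theorem for a family of continuous self-maps. -/
theorem exists_dense_orbit {X ι : Type*} [TopologicalSpace X] [BaireSpace X] [Nonempty X]
    [SecondCountableTopology X] {f : ι → X → X} (hf : ∀ i, Continuous (f i))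
    (h : ∀ U V : Set X, IsOpen U → U.Nonempty → IsOpen V → V.Nonempty →
      ∃ i, ∃ x ∈ U, f i x ∈ V) :
    ∃ x, Dense {y | ∃ i, y = f i x} := by
  let S := TopologicalSpace.countableBasis X
  have hS := TopologicalSpace.isBasis_countableBasis X
  have : Countable S := (TopologicalSpace.countable_countableBasis X).to_subtype
  have hne : ∀ V : S, (V : Set X).Nonempty := fun V =>
    TopologicalSpace.nonempty_of_mem_countableBasis V.2
  have hd : Dense (⋂ V : S, ⋃ i, f i ⁻¹' V) := by
    refine dense_iInter_of_isOpen (fun V => isOpen_iUnion fun i =>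
      (hS.isOpen V.2).preimage (hf i)) fun V => ?_
    rw [dense_iff_inter_open]
    intro U hU hUne
    obtain ⟨i, x, hx, hxV⟩ := h U V hU hUne (hS.isOpen V.2) (hne V)
    exact ⟨x, hx, mem_iUnion.2 ⟨i, hxV⟩⟩
  obtain ⟨x, hx⟩ := hd.nonempty
  refine ⟨x, hS.dense_iff.2 fun V hV _ => ?_⟩
  obtain ⟨i, hi⟩ := mem_iUnion.1 (mem_iInter.1 hx ⟨V, hV⟩)
  exact ⟨f i x, hi, i, rfl⟩

/-! ### Transitivity, mixing and periodic points in terms of the weight products. -/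

section Operator

variable {H : Type*} [NormedAddCommGroup H] [InnerProductSpace ℂ H]
variable {e : HilbertBasis ℕ ℂ H} {w : ℕ → ℝ} {B : H →L[ℂ] H}

theorem secondCountable_of_hilbertBasis (e : HilbertBasis ℕ ℂ H) : SecondCountableTopology H := by
  have := separableSpace_of_hilbertBasis e
  exact UniformSpace.secondCountable_of_separable H

/-- Perturbing a finitely supported vector by a small preimage of another one. -/
theorem IsBackwardShift.exists_mem_of_small (hB : IsBackwardShift e w B) (hw : ∀ n, 0 < w n)
    {m : ℕ → ℕ} (hm : Tendsto m atTop atTop)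
    (h : ∀ a, Tendsto (fun i => fwd e w (m i) a) atTop (𝓝 0))
    {U V : Set H} (hU : IsOpen U) (hUne : U.Nonempty) (hV : IsOpen V) (hVne : V.Nonempty) :
    ∀ᶠ i in atTop, ∃ x ∈ U, (B ^ m i) x ∈ V := by
  obtain ⟨a, ha⟩ := (denseRange_fwd_zero e hw).exists_mem_open hU hUne
  obtain ⟨b, hb⟩ := (denseRange_fwd_zero e hw).exists_mem_open hV hVne
  obtain ⟨N, hN⟩ := hB.exists_pow_fwd_eq_zero a
  have ht := (h b).const_add (fwd e w 0 a)
  rw [add_zero] at ht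
  filter_upwards [ht.eventually (hU.mem_nhds ha), hm.eventually_ge_atTop N] with i hi hiN
  refine ⟨_, hi, ?_⟩
  have h1 := hB.pow_fwd hw (m i) 0 b
  rw [add_zero] at h1
  rwa [map_add, hN _ hiN, zero_add, h1]

/-- Perturb `a` by `t • fwd e w N b` with `t` small. Since `B ^ N` kills `a`, the scalar `t⁻¹`
restores `b` exactly, so no growth of the weights is needed. -/
theorem IsBackwardShift.isSupercyclic [CompleteSpace H] (hB : IsBackwardShift e w B)
    (hw : ∀ n, 0 < w n) : IsSupercyclic B := by
  have := secondCountable_of_hilbertBasis e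
  obtain ⟨x, hx⟩ := exists_dense_orbit (f := fun (p : ℂ × ℕ) (x : H) => p.1 • (B ^ p.2) x)
    (fun p => by fun_prop) (by
      intro U V hU hUne hV hVne
      obtain ⟨a, ha⟩ := (denseRange_fwd_zero e hw).exists_mem_open hU hUne
      obtain ⟨b, hb⟩ := (denseRange_fwd_zero e hw).exists_mem_open hV hVne
      obtain ⟨N, hN⟩ := hB.exists_pow_fwd_eq_zero a
      have ht : Tendsto (fun t : ℂ => fwd e w 0 a + t • fwd e w N b) (𝓝[≠] 0)
          (𝓝 (fwd e w 0 a)) := by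
        have : Continuous fun t : ℂ => fwd e w 0 a + t • fwd e w N b := by fun_prop
        have h1 := this.tendsto 0
        rw [zero_smul, add_zero] at h1
        exact h1.mono_left nhdsWithin_le_nhds
      obtain ⟨t, htU, ht0⟩ :=
        ((ht.eventually (hU.mem_nhds ha)).and eventually_mem_nhdsWithin).exists
      refine ⟨(t⁻¹, N), _, htU, ?_⟩
      have h1 := hB.pow_fwd hw N 0 b
      rw [add_zero] at h1
      have ht0' : t ≠ 0 := ht0
      simpa only [map_add, hN _ le_rfl, zero_add, map_smul, h1, inv_smul_smul₀ ht0'] using hb)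
  refine ⟨x, hx.mono ?_⟩
  rintro y ⟨⟨c, n⟩, rfl⟩
  exact ⟨c, n, rfl⟩

theorem IsBackwardShift.isTopologicallyMixing (hB : IsBackwardShift e w B)
    (hw : ∀ n, 0 < w n) (hP : Tendsto (weightProd w) atTop atTop) :
    IsTopologicallyMixing B := by
  intro U V hU hUne hV hVne
  have h := hB.exists_mem_of_small hw (m := id) tendsto_id
    (fun a => by
      simpa using tendsto_fwd (e := e) (m := id) hw
        (fun k => hP.comp (tendsto_atTop_mono (fun n => Nat.le_add_left n k) tendsto_id)) a)
    hU hUne hV hVne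
  obtain ⟨N, hN⟩ := eventually_atTop.1 h
  refine ⟨max N 1, le_max_right _ _, fun m hm => ?_⟩
  obtain ⟨x, hx, hxV⟩ := hN m ((le_max_left _ _).trans hm)
  exact ⟨_, ⟨x, hx, rfl⟩, hxV⟩

/-- One step multiplies the product by at most `C`, so a huge value at one index forces large values
at the indices shortly before it. This makes the products large at `k + m i` for every `k` along a
single sequence `m`. -/
theorem exists_tendsto_weightProd (hw : ∀ n, 0 < w n) {C : ℝ} (hC : ∀ n, w n ≤ C)
    (hP : ¬ BddAbove (range (weightProd w))) :
    ∃ m : ℕ → ℕ, Tendsto m atTop atTop ∧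
      ∀ k, Tendsto (fun i => weightProd w (k + m i)) atTop atTop := by
  have hC0 : 0 < max C 1 := by positivity
  have h1 : ∀ i : ℕ, ∃ n, i ≤ n ∧ (i : ℝ) * max C 1 ^ i ≤ weightProd w (n + i) := by
    intro i
    -- The threshold is beyond every value at indices below `2 * i`, so `n - i ≥ i`; it also leaves
    -- room to go back `i` steps from `n`.
    obtain ⟨_, ⟨n, rfl⟩, hn⟩ :=
      not_bddAbove_iff.1 hP (max C 1 ^ (2 * i) * (i + 1))
    have hle : ∀ n < 2 * i, weightProd w n ≤ max C 1 ^ (2 * i) * (i + 1) := by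
      intro n hn
      have := weightProd_add_le hw (fun n => (hC n).trans (le_max_left C 1)) 0 n
      have h2 : max C 1 ^ n ≤ max C 1 ^ (2 * i) := pow_le_pow_right₀ (le_max_right _ _) hn.le
      rw [zero_add, show weightProd w 0 = 1 from Finset.prod_range_zero _, mul_one] at this
      have h3 : (0 : ℝ) < max C 1 ^ (2 * i) := by positivity
      have h4 : (0 : ℝ) ≤ i := by positivity
      nlinarith
    have h2i : 2 * i ≤ n := by
      by_contra! hlt
      exact absurd (hle n hlt) (not_le.2 hn)
    refine ⟨n - i, by omega, ?_⟩
    rw [Nat.sub_add_cancel (by omega)]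
    refine le_trans ?_ hn.le
    have h5 : max C 1 ^ i ≤ max C 1 ^ (2 * i) :=
      pow_le_pow_right₀ (le_max_right _ _) (by omega)
    have h4 : (0 : ℝ) ≤ i := by positivity
    have h6 : (0 : ℝ) < max C 1 ^ i := by positivity
    nlinarith
  choose m hm1 hm2 using h1
  refine ⟨m, tendsto_atTop_mono hm1 tendsto_id, fun k => ?_⟩
  refine tendsto_atTop_mono' _ ?_ tendsto_natCast_atTop_atTop
  filter_upwards [eventually_ge_atTop k] with i hi
  have h2 := weightProd_add_le hw (fun n => (hC n).trans (le_max_left C 1)) (k + m i) (i - k)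
  rw [show k + m i + (i - k) = m i + i by omega] at h2
  have h3 : max C 1 ^ (i - k) ≤ max C 1 ^ i :=
    pow_le_pow_right₀ (le_max_right _ _) (Nat.sub_le _ _)
  have h4 := weightProd_pos hw (k + m i)
  have h5 := hm2 i
  have h6 : (0 : ℝ) < max C 1 ^ i := by positivity
  have : (i : ℝ) * max C 1 ^ i ≤ weightProd w (k + m i) * max C 1 ^ i := by nlinarith
  exact le_of_mul_le_mul_right this h6

theorem IsBackwardShift.isHypercyclic [CompleteSpace H] (hB : IsBackwardShift e w B)
    (hw : ∀ n, 0 < w n) {C : ℝ} (hC : ∀ n, w n ≤ C)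
    (hP : ¬ BddAbove (range (weightProd w))) : IsHypercyclic B := by
  have := secondCountable_of_hilbertBasis e
  obtain ⟨m, hm, hmP⟩ := exists_tendsto_weightProd hw hC hP
  refine exists_dense_orbit (f := fun n x => (B ^ n) x) (fun n => by fun_prop) ?_
  intro U V hU hUne hV hVne
  obtain ⟨i, x, hx, hxV⟩ := (hB.exists_mem_of_small hw hm
    (fun a => tendsto_fwd hw hmP a) hU hUne hV hVne).exists
  exact ⟨m i, x, hx, hxV⟩

theorem exists_large_repr_zero (e : HilbertBasis ℕ ℂ H) (K : ℝ) :
    IsOpen {y : H | K < ‖e.repr y 0‖} ∧ {y : H | K < ‖e.repr y 0‖}.Nonempty := by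
  refine ⟨isOpen_lt continuous_const (continuous_repr_apply e 0).norm,
    ((|K| + 1 : ℝ) : ℂ) • e 0, ?_⟩
  rw [mem_ofPred_eq, repr_smul_apply, repr_basis_self, mul_one, Complex.norm_real,
    Real.norm_of_nonneg (by positivity)]
  linarith [le_abs_self K]

namespace IsBackwardShift

theorem norm_repr_pow_zero_le (hB : IsBackwardShift e w B) (hw : ∀ n, 0 < w n) (m : ℕ) (x : H) :
    ‖e.repr ((B ^ m) x) 0‖ ≤ weightProd w m * ‖x‖ := by
  rw [hB.repr_pow_zero, norm_mul, Complex.norm_real,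
    Real.norm_of_nonneg (weightProd_pos hw m).le]
  exact mul_le_mul_of_nonneg_left (norm_repr_le e x m) (weightProd_pos hw m).le

theorem not_isHypercyclic (hB : IsBackwardShift e w B) (hw : ∀ n, 0 < w n)
    (hP : BddAbove (range (weightProd w))) : ¬ IsHypercyclic B := by
  rintro ⟨x, hx⟩
  obtain ⟨K, hK⟩ := hP
  obtain ⟨ho, hne⟩ := exists_large_repr_zero e (K * ‖x‖)
  obtain ⟨_, ⟨n, rfl⟩, hy⟩ := hx.exists_mem_open ho hne
  refine absurd (hB.norm_repr_pow_zero_le hw n x) (not_le.2 (lt_of_le_of_lt ?_ hy))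
  exact mul_le_mul_of_nonneg_right (hK ⟨n, rfl⟩) (norm_nonneg x)

theorem not_isTopologicallyMixing (hB : IsBackwardShift e w B) (hw : ∀ n, 0 < w n)
    (hP : ¬ Tendsto (weightProd w) atTop atTop) : ¬ IsTopologicallyMixing B := by
  refine fun h => hP (tendsto_atTop.2 fun K => ?_)
  obtain ⟨ho, hne⟩ := exists_large_repr_zero e K
  obtain ⟨N, -, hN⟩ := h (Metric.ball 0 1) _ Metric.isOpen_ball ⟨0, by simp⟩ ho hne
  filter_upwards [eventually_ge_atTop N] with m hm
  obtain ⟨_, ⟨x, hx, rfl⟩, hxK⟩ := hN m hm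
  have h1 := hB.norm_repr_pow_zero_le hw m x
  have h2 : ‖x‖ < 1 := by simpa using hx
  have h3 : K < ‖e.repr ((B ^ m) x) 0‖ := hxK
  nlinarith [weightProd_pos hw m]

end IsBackwardShift

theorem IsTopologicallyMixing.isTopologicallyTransitive {A : H →L[ℂ] H}
    (h : IsTopologicallyMixing A) : IsTopologicallyTransitive A := by
  intro U V hU hUne hV hVne
  obtain ⟨n, hn, h⟩ := h U V hU hUne hV hVne
  exact ⟨n, hn, h n le_rfl⟩

/-- By linearity sensitivity at `0` suffices: transitivity sends some arbitrarily small `z` outside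
the unit ball, and `x + z` then separates from `x`. -/
theorem IsTopologicallyTransitive.isSensitive [Nontrivial H] {A : H →L[ℂ] H}
    (h : IsTopologicallyTransitive A) : IsSensitive A := by
  refine ⟨1, one_pos, fun x G hG => ?_⟩
  obtain ⟨G', hG', hG'o, hxG'⟩ := mem_nhds_iff.1 hG
  obtain ⟨y, hy⟩ := NormedSpace.exists_lt_norm ℂ H 1
  obtain ⟨n, -, _, ⟨z, hz, rfl⟩, hzn⟩ := h ((fun z => x + z) ⁻¹' G') {y | 1 < ‖y‖}
    (hG'o.preimage (by fun_prop)) ⟨0, by simpa using hxG'⟩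
    (isOpen_lt continuous_const continuous_norm) ⟨y, hy⟩
  refine ⟨x + z, hG' hz, n, ?_⟩
  rw [map_add, norm_sub_rev, add_sub_cancel_left]
  exact le_of_lt hzn

/-- The weight products diverge as soon as the periodic points are dense. -/
theorem IsBackwardShift.not_isChaotic (hB : IsBackwardShift e w B) (hw : ∀ n, 0 < w n) {C : ℝ}
    (hC : ∀ n, w n ≤ C) (hP : ¬ Tendsto (weightProd w) atTop atTop) : ¬ IsChaotic B := by
  rintro ⟨-, hd, -⟩
  obtain ⟨ho, hne⟩ := exists_large_repr_zero e 0
  obtain ⟨x, ⟨k, hk, hkx⟩, hx⟩ := hd.exists_mem_open ho hne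
  have hx0 : 0 < ‖e.repr x 0‖ := hx
  have hper : ∀ j, (B ^ (k * j)) x = x := by
    intro j
    induction j with
    | zero => simp
    | succ j ih => rw [mul_add, mul_one, pow_add, mul_apply_eq_comp, hkx, ih]
  -- Along multiples of the period the zeroth coordinate stays constant while the coordinates of `x`
  -- tend to `0`, so the products must diverge there.
  have hcoord : ∀ j, weightProd w (k * j) * ‖e.repr x (k * j)‖ = ‖e.repr x 0‖ := by
    intro j
    conv_rhs => rw [← hper j, hB.repr_pow_zero, norm_mul, Complex.norm_real,
      Real.norm_of_nonneg (weightProd_pos hw _).le]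
  have hl2 : Tendsto (fun n => ‖e.repr x n‖) atTop (𝓝 0) := by
    have h1 : Summable fun n => ‖e.repr x n‖ ^ 2 := by
      have := (lp.memℓp (e.repr x)).summable (by norm_num)
      simpa using this
    have h2 := h1.tendsto_atTop_zero.sqrt
    simpa [Real.sqrt_sq (norm_nonneg _)] using h2
  refine hP (tendsto_atTop.2 fun K => ?_)
  have hC1 : ∀ n, w n ≤ max C 1 := fun n => (hC n).trans (le_max_left C 1)
  set D := max C 1 ^ k with hD
  have hDpos : 0 < D := by positivity
  have hev := hl2.eventually_lt_const (show 0 < ‖e.repr x 0‖ / (D * (|K| + 1)) by positivity)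
  obtain ⟨N, hN⟩ := eventually_atTop.1 hev
  filter_upwards [eventually_ge_atTop N] with n hn
  -- The next multiple of `k` after `n` is at most `k` steps away, which costs at most the factor
  -- `D`.
  set j := n / k + 1
  have hj : n ≤ k * j ∧ k * j - n ≤ k := by
    have h1 := Nat.div_add_mod n k
    have h2 := Nat.mod_lt n hk
    have h3 : k * j = k * (n / k) + k := by ring
    omega
  have h1 := weightProd_add_le hw hC1 n (k * j - n)
  rw [Nat.add_sub_cancel' hj.1] at h1
  have h2 : max C 1 ^ (k * j - n) ≤ D := pow_le_pow_right₀ (le_max_right _ _) hj.2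
  have h3 := hN (k * j) (hn.trans hj.1)
  rw [lt_div_iff₀ (by positivity)] at h3
  have h4 := hcoord j
  have h5 := weightProd_pos hw n
  have h6 := weightProd_pos hw (k * j)
  have h7 : 0 < ‖e.repr x (k * j)‖ := by
    by_contra! h
    have : ‖e.repr x (k * j)‖ = 0 := le_antisymm h (norm_nonneg _)
    rw [this, mul_zero] at h4
    exact hx0.ne h4
  have h8 : D * (|K| + 1) < weightProd w (k * j) := by
    rw [← h4, mul_comm (weightProd w _)] at h3
    exact lt_of_mul_lt_mul_left h3 h7.le
  have h9 : D * (|K| + 1) < D * weightProd w n :=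
    h8.trans_le (h1.trans (mul_le_mul_of_nonneg_right h2 h5.le))
  have h10 := lt_of_mul_lt_mul_left h9 hDpos.le
  linarith [le_abs_self K]

/-! ### Li–Yorke chaos -/

/-- For a contraction the norms along an orbit decrease, so their upper and lower limits coincide.
-/
theorem not_isLiYorkeChaotic_of_norm_le {A : H →L[ℂ] H} (hA : ∀ x, ‖A x‖ ≤ ‖x‖) :
    ¬ IsLiYorkeChaotic A := by
  rintro ⟨G, hG, h⟩
  have hnt : G.Nontrivial := by
    by_contra hn
    exact hG (Set.not_nontrivial_iff.1 hn).countable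
  obtain ⟨x, hx, y, hy, hxy⟩ := hnt
  obtain ⟨h1, h2⟩ := h x hx y hy hxy
  have hanti : Antitone fun n : ℕ => ‖(A ^ n) (x - y)‖ₑ := by
    refine antitone_nat_of_succ_le fun n => ?_
    rw [pow_succ', mul_apply_eq_comp]
    exact enorm_le_iff_norm_le.2 (hA _)
  have ht := tendsto_atTop_iInf hanti
  rw [ht.limsup_eq] at h1
  rw [ht.liminf_eq] at h2
  exact h1.ne' h2

/-- A single irregular vector suffices: differences of points on the line `ℂ x` are multiples of
`x`, so the whole line is scrambled. -/
theorem isLiYorkeChaotic_of_exists {A : H →L[ℂ] H} {x : H}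
    (h0 : ∀ ε > 0, ∃ᶠ n in atTop, ‖(A ^ n) x‖ < ε) (h1 : ∀ K : ℝ, ∃ᶠ n in atTop, K < ‖(A ^ n) x‖) :
    IsLiYorkeChaotic A := by
  have hx : x ≠ 0 := by
    rintro rfl
    obtain ⟨n, hn⟩ := (h1 0).exists
    simp at hn
  refine ⟨range fun c : ℂ => c • x, ?_, ?_⟩
  · intro hc
    have hinj : Function.Injective fun c : ℂ => c • x := smul_left_injective ℂ hx
    have h := hc.preimage hinj
    rw [preimage_range] at h
    exact not_countable_complex h
  · rintro _ ⟨c, rfl⟩ _ ⟨d, rfl⟩ hcd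
    have hne : c - d ≠ 0 := by
      intro h
      rw [sub_eq_zero.1 h] at hcd
      exact hcd rfl
    have hpos : 0 < ‖c - d‖ := norm_pos_iff.2 hne
    have hn : ∀ n, ‖(A ^ n) (c • x - d • x)‖ = ‖c - d‖ * ‖(A ^ n) x‖ := by
      intro n
      rw [← sub_smul, map_smul, norm_smul]
    constructor
    · refine lt_of_lt_of_le zero_lt_one (le_limsup_of_frequently_le ?_)
      refine (h1 (‖c - d‖⁻¹)).mono fun n h => ?_
      rw [← ofReal_norm, hn, ← ENNReal.ofReal_one]
      refine ENNReal.ofReal_le_ofReal ?_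
      rw [inv_lt_iff_one_lt_mul₀ hpos, mul_comm] at h
      exact h.le
    · refine le_antisymm (ENNReal.le_of_forall_pos_le_add fun ε hε _ => ?_) zero_le
      rw [zero_add]
      refine liminf_le_of_frequently_le ?_
      refine (h0 (ε / ‖c - d‖) (by positivity)).mono fun n h => ?_
      rw [← ofReal_norm, hn, ← ENNReal.ofReal_coe_nnreal]
      refine ENNReal.ofReal_le_ofReal ?_
      rw [lt_div_iff₀ hpos] at h
      linarith

/-- A vector whose orbit is unbounded and accumulates at `0`, by a Baire category argument. -/
theorem exists_irregular [CompleteSpace H] {A : H →L[ℂ] H}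
    (h0 : Dense {x : H | ∃ n, ∀ m ≥ n, (A ^ m) x = 0})
    (h1 : ∀ K : ℝ, ∃ (n : ℕ) (x : H), ‖x‖ ≤ 1 ∧ K < ‖(A ^ n) x‖) :
    ∃ x, (∀ ε > 0, ∃ᶠ n in atTop, ‖(A ^ n) x‖ < ε) ∧
      ∀ K : ℝ, ∃ᶠ n in atTop, K < ‖(A ^ n) x‖ := by
  have hcont : ∀ n : ℕ, Continuous fun x : H => ‖(A ^ n) x‖ := fun n => by fun_prop
  have hd1 : Dense (⋂ p : ℕ × ℕ, ⋃ n ≥ p.1, {x : H | ‖(A ^ n) x‖ < 1 / ((p.2 : ℝ) + 1)}) := by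
    refine dense_iInter_of_isOpen (fun p => isOpen_iUnion fun n => isOpen_iUnion fun _ =>
      isOpen_lt (hcont n) continuous_const) fun p => h0.mono ?_
    rintro x ⟨n, hn⟩
    refine mem_iUnion₂.2 ⟨max n p.1, le_max_right _ _, ?_⟩
    rw [mem_ofPred_eq, hn _ (le_max_left _ _), norm_zero]
    positivity
  have hd2 : Dense (⋂ k : ℕ, ⋃ n, {x : H | (k : ℝ) < ‖(A ^ n) x‖}) := by
    refine dense_iInter_of_isOpen (fun p => isOpen_iUnion fun n =>
      isOpen_lt continuous_const (hcont n)) fun k => ?_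
    rw [Metric.dense_iff]
    intro x r hr
    by_contra hcon
    have hb : ∀ y ∈ Metric.ball x r, ∀ n, ‖(A ^ n) y‖ ≤ k := by
      intro y hy n
      by_contra! hlt
      exact hcon ⟨y, hy, mem_iUnion.2 ⟨n, hlt⟩⟩
    -- If all orbits from a ball of radius `r` were bounded by `k`, subtracting two of them would
    -- bound every power on the unit ball by `2 * k / (r / 2)`.
    obtain ⟨n, y, hy, hny⟩ := h1 (2 * k / (r / 2))
    have h2 := hb x (Metric.mem_ball_self hr) n
    have h3 := hb (x + ((r / 2 : ℝ) : ℂ) • y) (by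
      rw [mem_ball_iff_norm, add_sub_cancel_left, norm_smul, Complex.norm_real,
        Real.norm_of_nonneg (by positivity)]
      nlinarith) n
    have h4 : (r / 2) * ‖(A ^ n) y‖ ≤ 2 * k := by
      calc (r / 2) * ‖(A ^ n) y‖ = ‖(A ^ n) (x + ((r / 2 : ℝ) : ℂ) • y) - (A ^ n) x‖ := by
            rw [map_add, add_sub_cancel_left, map_smul, norm_smul, Complex.norm_real,
              Real.norm_of_nonneg (by positivity)]
        _ ≤ _ := (norm_sub_le _ _).trans (by linarith)
    rw [div_lt_iff₀ (by positivity)] at hny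
    linarith
  have hG : ∀ p : ℕ × ℕ,
      IsOpen (⋃ n ≥ p.1, {x : H | ‖(A ^ n) x‖ < 1 / ((p.2 : ℝ) + 1)}) := fun p =>
    isOpen_iUnion fun n => isOpen_iUnion fun _ => isOpen_lt (hcont n) continuous_const
  have hG2 : ∀ k : ℕ, IsOpen (⋃ n, {x : H | (k : ℝ) < ‖(A ^ n) x‖}) := fun k =>
    isOpen_iUnion fun n => isOpen_lt continuous_const (hcont n)
  obtain ⟨x, hx1, hx2⟩ := (hd1.inter_of_Gδ (IsGδ.iInter_of_isOpen hG)
    (IsGδ.iInter_of_isOpen hG2) hd2).nonempty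
  refine ⟨x, fun ε hε => ?_, fun K => ?_⟩
  · rw [frequently_atTop]
    intro a
    obtain ⟨k, hk⟩ := exists_nat_one_div_lt hε
    obtain ⟨n, hn, hnx⟩ := mem_iUnion₂.1 (mem_iInter.1 hx1 (a, k))
    exact ⟨n, hn, lt_trans hnx hk⟩
  · rw [frequently_atTop]
    intro a
    -- Exceeding also the first `a` norms of the orbit forces the index found below to be at least
    -- `a`.
    obtain ⟨k, hk⟩ := exists_nat_gt (max K (∑ i ∈ Finset.range a, ‖(A ^ i) x‖))
    obtain ⟨n, hn⟩ := mem_iUnion.1 (mem_iInter.1 hx2 k)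
    have hn' : (k : ℝ) < ‖(A ^ n) x‖ := hn
    refine ⟨n, ?_, (le_max_left _ _).trans_lt (hk.trans hn')⟩
    by_contra! hna
    have := Finset.single_le_sum (f := fun i => ‖(A ^ i) x‖) (fun i _ => norm_nonneg _)
      (Finset.mem_range.2 hna)
    have h3 := le_max_right K (∑ i ∈ Finset.range a, ‖(A ^ i) x‖)
    linarith

/-- A run of `L` weights at least `ρ` starting at `k` stretches `e (k + L)` by at least `ρ ^ L`
under `B ^ L`, while finitely supported vectors have orbits ending in `0`. -/
theorem IsBackwardShift.isLiYorkeChaotic [CompleteSpace H] (hB : IsBackwardShift e w B)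
    (hw : ∀ n, 0 < w n) {ρ : ℝ} (hρ : 1 < ρ)
    (hrun : ∀ L : ℕ, ∃ k, ∀ i < L, ρ ≤ w (k + i)) : IsLiYorkeChaotic B := by
  obtain ⟨x, hx0, hx1⟩ := exists_irregular (A := B)
    ((denseRange_fwd_zero e hw).mono (by
      rintro _ ⟨a, rfl⟩
      exact hB.exists_pow_fwd_eq_zero a)) (by
      intro K
      obtain ⟨L, hL⟩ := pow_unbounded_of_one_lt K hρ
      obtain ⟨k, hk⟩ := hrun L
      refine ⟨L, e (k + L), (e.orthonormal.1 _).le, hL.trans_le ?_⟩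
      have h1 : ∀ l ≤ L, ρ ^ l * weightProd w k ≤ weightProd w (k + l) := by
        intro l hl
        induction l with
        | zero => simp
        | succ l ih =>
          rw [← add_assoc, weightProd_succ, pow_succ]
          have h2 := hk l (by omega)
          have h3 := ih (by omega)
          have h4 := weightProd_pos hw k
          calc ρ ^ l * ρ * weightProd w k = (ρ ^ l * weightProd w k) * ρ := by ring
            _ ≤ _ := mul_le_mul h3 h2 (by linarith) (weightProd_pos hw _).le
      have h2 := hB.repr_pow L k (e (k + L))
      rw [repr_basis_self, mul_one] at h2
      have h3 := congrArg norm h2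
      rw [norm_mul, Complex.norm_real, Complex.norm_real,
        Real.norm_of_nonneg (weightProd_pos hw _).le,
        Real.norm_of_nonneg (weightProd_pos hw _).le] at h3
      have h4 := norm_repr_le e ((B ^ L) (e (k + L))) k
      have h5 := h1 L le_rfl
      have h6 := weightProd_pos hw k
      refine le_trans ?_ h4
      rw [← h3, mul_comm] at h5
      exact le_of_mul_le_mul_left h5 h6)
  exact isLiYorkeChaotic_of_exists hx0 hx1

theorem IsBackwardShift.norm_apply_le (hB : IsBackwardShift e w B) (hw : ∀ n, |w n| ≤ 1) (x : H) :
    ‖B x‖ ≤ ‖x‖ := by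
  have hs : ∀ y : H, Summable fun n => ‖e.repr y n‖ ^ 2 := fun y => by
    simpa using (lp.memℓp (e.repr y)).summable (by norm_num)
  have hn : ∀ y : H, ‖y‖ ^ 2 = ∑' n, ‖e.repr y n‖ ^ 2 := fun y => by
    rw [← e.repr.norm_map y]
    simpa using lp.norm_rpow_eq_tsum (p := 2) (by norm_num) (e.repr y)
  refine le_of_sq_le_sq ?_ (norm_nonneg x)
  rw [hn, hn, (hs x).tsum_eq_zero_add]
  refine le_add_of_nonneg_of_le (by positivity) ?_
  refine Summable.tsum_le_tsum (fun n => ?_) (hs _) ((summable_nat_add_iff 1).2 (hs x))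
  rw [hB, norm_mul, Complex.norm_real, Real.norm_eq_abs]
  gcongr
  exact mul_le_of_le_one_left (norm_nonneg _) (hw n)

end Operator

/-! ### Lower density and separated sets -/

/-- A real `liminf` is meaningful only under boundedness; this bound supplies it for `lowerDensity`.
-/
theorem ncard_inter_Icc_div_le_one (S : Set ℕ) (n : ℕ) :
    ((S ∩ Set.Icc 1 n).ncard : ℝ) / n ≤ 1 := by
  refine div_le_one_of_le₀ ?_ n.cast_nonneg
  have h := Set.ncard_le_ncard (inter_subset_right : S ∩ Set.Icc 1 n ⊆ Set.Icc 1 n)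
    (Set.finite_Icc 1 n)
  rw [← Finset.coe_Icc, Set.ncard_coe_finset, Nat.card_Icc] at h
  rw [Finset.coe_Icc] at h
  exact_mod_cast h

theorem lowerDensity_pos_of_le {S : Set ℕ} {c : ℝ} (hc : 0 < c)
    (h : ∀ N : ℕ, c * N - 1 ≤ ((S ∩ Set.Icc 1 N).ncard : ℝ)) : 0 < lowerDensity S := by
  refine lt_of_lt_of_le (half_pos hc) (le_liminf_of_le ?_ ?_)
  · exact (isBoundedUnder_of ⟨1, ncard_inter_Icc_div_le_one S⟩).isCoboundedUnder_ge
  · obtain ⟨N₀, hN₀⟩ := exists_nat_gt (2 / c)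
    filter_upwards [eventually_gt_atTop N₀] with N hN
    have hN0 : (0 : ℝ) < N := by exact_mod_cast (Nat.zero_le _).trans_lt hN
    rw [le_div_iff₀ hN0]
    have h1 : 2 / c < N := hN₀.trans (by exact_mod_cast hN)
    rw [div_lt_iff₀ hc] at h1
    linarith [h N]

theorem lowerDensity_mono {S T : Set ℕ} (h : S ⊆ T) : lowerDensity S ≤ lowerDensity T := by
  refine liminf_le_liminf (Eventually.of_forall fun n => ?_)
    (isBoundedUnder_of ⟨0, fun n => by positivity⟩)
    (isBoundedUnder_of ⟨1, ncard_inter_Icc_div_le_one T⟩).isCoboundedUnder_ge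
  have := Set.ncard_le_ncard (inter_subset_inter_left (Set.Icc 1 n) h)
    ((Set.finite_Icc 1 n).subset inter_subset_right)
  gcongr

/-- Rapidly increasing periods. -/
def period (l : ℕ → ℕ) : ℕ → ℕ
  | 0 => 12 * l 0
  | j + 1 => 12 * 2 ^ (j + 1) * l (j + 1) * period l j

theorem period_pos {l : ℕ → ℕ} (hl : ∀ j, 1 ≤ l j) (j : ℕ) : 0 < period l j := by
  induction j with
  | zero => have := hl 0; rw [period]; omega
  | succ j ih => rw [period]; have := hl (j + 1); positivity

theorem le_period {l : ℕ → ℕ} (hl : ∀ j, 1 ≤ l j) (j : ℕ) : 12 * 2 ^ j * l j ≤ period l j := by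
  cases j with
  | zero => simp [period]
  | succ j => rw [period]; exact Nat.le_mul_of_pos_right _ (period_pos hl j)

/-- The factor `12 * 2 ^ j * l j` makes the integers within `l j` of a multiple of `period l j` so
rare that, summed over `j > k`, they use up at most two thirds of the density of the multiples of
`period l k`. -/
theorem le_period_of_lt {l : ℕ → ℕ} (hl : ∀ j, 1 ≤ l j) {k j : ℕ} (h : k < j) :
    12 * 2 ^ j * l j * period l k ≤ period l j := by
  have hmono : Monotone (period l) := by
    refine monotone_nat_of_le_succ fun n => ?_
    rw [period]
    have := hl (n + 1)
    exact Nat.le_mul_of_pos_left _ (by positivity)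
  obtain ⟨j, rfl⟩ := Nat.exists_eq_succ_of_ne_zero (Nat.ne_zero_of_lt h)
  rw [Nat.succ_eq_add_one, period]
  exact Nat.mul_le_mul_left _ (hmono (Nat.lt_succ_iff.1 h))

/-- The positive multiples of `period l k` that stay at distance `l j` from the positive multiples
of `period l j`, for all `j > k`. -/
def sepSet (l : ℕ → ℕ) (k : ℕ) : Set ℕ :=
  {n | (∃ t, n = (t + 1) * period l k) ∧
    ∀ j > k, ∀ t, n + l j ≤ (t + 1) * period l j ∨ (t + 1) * period l j + l j ≤ n}

theorem le_of_mem_sepSet {l : ℕ → ℕ} (hl : ∀ j, 1 ≤ l j) {k n : ℕ} (h : n ∈ sepSet l k) :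
    l k ≤ n := by
  obtain ⟨⟨t, rfl⟩, -⟩ := h
  have h1 := le_period hl k
  have h2 : 0 < 2 ^ k := by positivity
  nlinarith [Nat.zero_le t, Nat.zero_le (t * period l k), hl k]

/-- If `j < k` the definition gives the gap `l k ≥ l j`, if `j > k` it gives `l j`. Applied in both
orders, the lemma separates by the larger of the two gaps, and it shows that the sets are disjoint.
-/
theorem sepSet_separated {l : ℕ → ℕ} (hl : ∀ j, 1 ≤ l j) (hmono : Monotone l) {j k n m : ℕ}
    (hn : n ∈ sepSet l j) (hm : m ∈ sepSet l k) (hne : (n, j) ≠ (m, k)) :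
    n + l j ≤ m ∨ m + l j ≤ n := by
  obtain ⟨⟨t, rfl⟩, hn⟩ := hn
  obtain ⟨⟨s, rfl⟩, hm⟩ := hm
  rcases lt_trichotomy j k with h | rfl | h
  · have := hn k h s
    have := hmono h.le
    omega
  · have h1 := le_period hl j
    have h2 : l j ≤ period l j := by
      have : 0 < 2 ^ j := by positivity
      nlinarith [hl j]
    have hts : t ≠ s := by
      rintro rfl; exact hne rfl
    rcases lt_or_gt_of_ne hts with h | h
    · left
      have : (t + 1 + 1) * period l j ≤ (s + 1) * period l j := Nat.mul_le_mul_right _ (by omega)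
      linarith
    · right
      have : (s + 1 + 1) * period l j ≤ (t + 1) * period l j := Nat.mul_le_mul_right _ (by omega)
      linarith
  · have := hm j h t
    omega

open scoped Classical in
theorem card_near_multiples_le {p l : ℕ} (hp : 2 * l ≤ p) (hp0 : 0 < p) (N : ℕ) :
    (((Finset.Icc 1 N).filter
      fun n => ∃ t, (t + 1) * p < n + l ∧ n < (t + 1) * p + l).card : ℝ) ≤ 4 * N * l / p := by
  have hsub : ((Finset.Icc 1 N).filter
      fun n => ∃ t, (t + 1) * p < n + l ∧ n < (t + 1) * p + l) ⊆
      (Finset.range (2 * N / p)).biUnion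
        fun t => Finset.Ico ((t + 1) * p - l) ((t + 1) * p + l) := by
    intro n hn
    simp only [Finset.mem_filter, Finset.mem_Icc] at hn
    obtain ⟨⟨hn1, hnN⟩, t, ht1, ht2⟩ := hn
    simp only [Finset.mem_biUnion, Finset.mem_range, Finset.mem_Ico]
    refine ⟨t, ?_, by omega, ht2⟩
    rw [← Nat.succ_le_iff, Nat.le_div_iff_mul_le hp0]
    -- From `2 * l ≤ p ≤ (t + 1) * p` and `(t + 1) * p < N + l` it follows that `(t + 1) * p ≤ 2 *
    -- N`.
    have h1 : p ≤ (t + 1) * p := Nat.le_mul_of_pos_left _ (by omega)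
    have h2 : (t + 1) * p < N + l := by omega
    rw [Nat.succ_eq_add_one]
    omega
  have h1 : ((Finset.Icc 1 N).filter
      fun n => ∃ t, (t + 1) * p < n + l ∧ n < (t + 1) * p + l).card ≤ (2 * N / p) * (2 * l) := by
    refine (Finset.card_le_card hsub).trans ?_
    refine (Finset.card_biUnion_le_card_mul _ _ (2 * l) fun t _ => ?_).trans ?_
    · rw [Nat.card_Ico]; omega
    · rw [Finset.card_range]
  calc (((Finset.Icc 1 N).filter
      fun n => ∃ t, (t + 1) * p < n + l ∧ n < (t + 1) * p + l).card : ℝ)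
      ≤ ((2 * N / p : ℕ) : ℝ) * (2 * l) := by exact_mod_cast h1
    _ ≤ ((2 * N : ℕ) : ℝ) / p * (2 * l) := by gcongr; exact Nat.cast_div_le
    _ = _ := by push_cast; ring

/-- Of the multiples of `period l k` up to `N`, at least `N / period l k - 1` in number, at most `2
* N / (3 * period l k)` are discarded. -/
theorem sepSet_card {l : ℕ → ℕ} (hl : ∀ j, 1 ≤ l j) (k N : ℕ) :
    (3 * (period l k : ℝ))⁻¹ * N - 1 ≤ ((sepSet l k ∩ Set.Icc 1 N).ncard : ℝ) := by
  classical
  set p := period l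
  have hp0 : (0 : ℝ) < p k := by exact_mod_cast period_pos hl k
  let bad : ℕ → Finset ℕ := fun j => (Finset.Icc 1 N).filter
      fun n => ∃ t, (t + 1) * p j < n + l j ∧ n < (t + 1) * p j + l j
  let S : Finset ℕ := (Finset.Icc 1 N).filter (· ∈ sepSet l k)
  have hS : (sepSet l k ∩ Set.Icc 1 N).ncard = S.card := by
    rw [← Set.ncard_coe_finset]
    congr 1
    ext n
    simp [S, and_comm]
  have hp2 : ∀ j, 2 * l j ≤ p j := fun j => by
    have := le_period hl j
    have : 0 < 2 ^ j := by positivity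
    nlinarith [hl j]
  have hsub : (Finset.Ioc 0 N).filter (p k ∣ ·) ⊆
      S ∪ ((Finset.range (2 * N)).filter (k < ·)).biUnion bad := by
    intro n hn
    simp only [Finset.mem_filter, Finset.mem_Ioc] at hn
    obtain ⟨⟨hn1, hnN⟩, t, ht⟩ := hn
    by_cases hmem : n ∈ sepSet l k
    · refine Finset.mem_union_left _ ?_
      simp only [S, Finset.mem_filter, Finset.mem_Icc]
      exact ⟨⟨hn1, hnN⟩, hmem⟩
    · refine Finset.mem_union_right _ ?_
      have h1 : ∃ t, n = (t + 1) * p k := by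
        cases t with
        | zero => omega
        | succ t => exact ⟨t, by rw [ht, mul_comm]⟩
      have h2 : ∃ j > k, ∃ t, (t + 1) * p j < n + l j ∧ n < (t + 1) * p j + l j := by
        by_contra hcon
        push Not at hcon
        refine hmem ⟨h1, fun j hj t => ?_⟩
        have := hcon j hj t
        change n + l j ≤ (t + 1) * p j ∨ (t + 1) * p j + l j ≤ n
        omega
      obtain ⟨j, hj, s, hs⟩ := h2
      simp only [Finset.mem_biUnion, Finset.mem_filter, Finset.mem_range, bad, Finset.mem_Icc]
      refine ⟨j, ⟨?_, hj⟩, ⟨hn1, hnN⟩, s, hs⟩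
      have h3 : p j ≤ (s + 1) * p j := Nat.le_mul_of_pos_left _ (by omega)
      have h4 := hp2 j
      have h5 : j < p j := by
        have h6 := le_period hl j
        have h7 := Nat.lt_two_pow_self (n := j)
        have h8 : 2 ^ j ≤ 12 * 2 ^ j * l j := by nlinarith [hl j]
        exact h7.trans_le (h8.trans h6)
      omega
  have hcard := (Finset.card_le_card hsub).trans (Finset.card_union_le _ _)
  rw [Nat.Ioc_filter_dvd_card_eq_div] at hcard
  have hbad : ∀ j, k < j → ((bad j).card : ℝ) ≤ N / (3 * p k) * (1 / 2) ^ j := by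
    intro j hj
    refine (card_near_multiples_le (hp2 j) (period_pos hl j) N).trans ?_
    have h1 : (12 * 2 ^ j * l j * p k : ℝ) ≤ p j := by exact_mod_cast le_period_of_lt hl hj
    have hpj : (0 : ℝ) < p j := by exact_mod_cast period_pos hl j
    rw [div_le_iff₀ hpj]
    have h2 : (N : ℝ) / (3 * p k) * (1 / 2) ^ j * (12 * 2 ^ j * l j * p k) = 4 * N * l j := by
      have : ((1 : ℝ) / 2) ^ j * 2 ^ j = 1 := by rw [← mul_pow]; norm_num
      field_simp
      field_simp at this
      linear_combination (12 * (N : ℝ) * l j) * this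
    rw [← h2]
    gcongr
  have hsum : ((((Finset.range (2 * N)).filter (k < ·)).biUnion bad).card : ℝ)
      ≤ N / (3 * p k) * 2 := by
    calc ((((Finset.range (2 * N)).filter (k < ·)).biUnion bad).card : ℝ)
        ≤ ∑ j ∈ (Finset.range (2 * N)).filter (k < ·), ((bad j).card : ℝ) := by
          exact_mod_cast Finset.card_biUnion_le
      _ ≤ ∑ j ∈ (Finset.range (2 * N)).filter (k < ·), (N : ℝ) / (3 * p k) * (1 / 2) ^ j :=
          Finset.sum_le_sum fun j hj => hbad j (Finset.mem_filter.1 hj).2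
      _ ≤ ∑ j ∈ Finset.range (2 * N), (N : ℝ) / (3 * p k) * (1 / 2) ^ j :=
          Finset.sum_le_sum_of_subset_of_nonneg (Finset.filter_subset _ _)
            fun _ _ _ => by positivity
      _ = N / (3 * p k) * ∑ j ∈ Finset.range (2 * N), (1 / 2 : ℝ) ^ j := by
          rw [Finset.mul_sum]
      _ ≤ _ := by
          gcongr
          exact sum_geometric_two_le _
  have hdiv : (N : ℝ) / p k - 1 ≤ ((N / p k : ℕ) : ℝ) := by
    have := Nat.lt_div_mul_add (a := N) (period_pos hl k)
    rw [sub_le_iff_le_add, div_le_iff₀ hp0]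
    have h2 : (N : ℝ) < (N / p k : ℕ) * p k + p k := by exact_mod_cast this
    linarith
  have hcard' : ((N / p k : ℕ) : ℝ) ≤ S.card + N / (3 * p k) * 2 := by
    refine le_trans ?_ (add_le_add_right hsum (S.card : ℝ))
    exact_mod_cast hcard
  rw [hS]
  have h3 : (3 * (p k : ℝ))⁻¹ * N = N / p k - N / (3 * p k) * 2 := by
    field_simp
    ring
  rw [h3]
  linarith

/-! ### Chaos and frequent hypercyclicity under exponential growth of the weight products. -/

section Operator

variable {H : Type*} [NormedAddCommGroup H] [InnerProductSpace ℂ H]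
variable {e : HilbertBasis ℕ ℂ H} {w : ℕ → ℝ} {B : H →L[ℂ] H}

/-- The series `∑ j, fwd e w (j * N) a` is fixed by `B ^ N`, which kills the zeroth term and moves
every other term down by one. For large `N` it is close to its zeroth term. -/
theorem IsBackwardShift.dense_periodic [CompleteSpace H] (hB : IsBackwardShift e w B) (hw : ∀ n, 0 < w n)
    {c ρ : ℝ} (hc : 0 < c) (hρ : 0 < ρ) (hρ1 : ρ < 1)
    (hP : ∀ n, c * (ρ⁻¹) ^ n ≤ weightProd w n) :
    Dense {x : H | ∃ k : ℕ, 1 ≤ k ∧ (B ^ k) x = x} := by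
  rw [Metric.dense_iff]
  intro y r hr
  obtain ⟨a, ha⟩ := (denseRange_fwd_zero e hw).exists_mem_open Metric.isOpen_ball
    ⟨y, Metric.mem_ball_self (half_pos hr)⟩
  obtain ⟨M, hM⟩ := exists_norm_fwd_le (e := e) hw hc hρ hP a
  obtain ⟨N₀, hN₀⟩ := hB.exists_pow_fwd_eq_zero a
  have ht : Tendsto (fun N : ℕ => M * ρ ^ N * (1 - ρ)⁻¹) atTop (𝓝 0) := by
    simpa using ((tendsto_pow_atTop_nhds_zero_of_lt_one hρ.le hρ1).const_mul M).mul_const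
      (1 - ρ)⁻¹
  obtain ⟨N, hN1, hN2, hN3⟩ := ((ht.eventually_lt_const (half_pos hr)).and
    ((eventually_ge_atTop N₀).and (eventually_ge_atTop 1))).exists
  have hM0 : 0 ≤ M := by simpa using (norm_nonneg _).trans (hM 0)
  have hgeo := (summable_geometric_of_lt_one hρ.le hρ1)
  have hbound : ∀ j, ‖fwd e w ((j + 1) * N) a‖ ≤ M * ρ ^ N * ρ ^ j := by
    intro j
    refine (hM _).trans ?_
    rw [mul_assoc, ← pow_add]
    refine mul_le_mul_of_nonneg_left (pow_le_pow_of_le_one hρ.le hρ1.le ?_) hM0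
    nlinarith
  have hs1 : Summable fun j => fwd e w ((j + 1) * N) a :=
    Summable.of_norm_bounded (hgeo.mul_left _) hbound
  have hs : Summable fun j => fwd e w (j * N) a :=
    (summable_nat_add_iff (f := fun j => fwd e w (j * N) a) 1).1 hs1
  refine ⟨∑' j, fwd e w (j * N) a, ?_, N, hN3, ?_⟩
  · rw [hs.tsum_eq_zero_add, zero_mul, mem_ball_iff_norm]
    have h1 : ‖∑' j, fwd e w ((j + 1) * N) a‖ ≤ M * ρ ^ N * (1 - ρ)⁻¹ :=
      tsum_of_norm_bounded ((hasSum_geometric_of_lt_one hρ.le hρ1).mul_left _) hbound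
    have h2 : ‖fwd e w 0 a - y‖ < r / 2 := mem_ball_iff_norm.1 ha
    rw [add_sub_right_comm]
    exact (norm_add_le _ _).trans_lt (by linarith)
  · rw [(B ^ N).map_tsum hs, (hs.mapL (B ^ N)).tsum_eq_zero_add, zero_mul, hN₀ N hN2, zero_add]
    congr 1
    funext j
    rw [add_mul, one_mul, add_comm, hB.pow_fwd hw]

theorem IsBackwardShift.isChaotic [CompleteSpace H] (hB : IsBackwardShift e w B) (hw : ∀ n, 0 < w n)
    {c ρ : ℝ} (hc : 0 < c) (hρ : 0 < ρ) (hρ1 : ρ < 1)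
    (hP : ∀ n, c * (ρ⁻¹) ^ n ≤ weightProd w n) : IsChaotic B := by
  have : Nontrivial H := ⟨⟨e 0, 0, e.orthonormal.ne_zero 0⟩⟩
  have ht : Tendsto (weightProd w) atTop atTop := by
    refine tendsto_atTop_mono hP ?_
    exact (tendsto_pow_atTop_atTop_of_one_lt ((one_lt_inv₀ hρ).2 hρ1)).const_mul_atTop hc
  have h := (hB.isTopologicallyMixing hw ht).isTopologicallyTransitive
  exact ⟨h, hB.dense_periodic hw hc hρ hρ1 hP, h.isSensitive⟩

/-- Passing from `ρ` to a larger `σ` absorbs the constant depending on `a`, at the price of starting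
at a late index. -/
theorem exists_fwd_bounds (hB : IsBackwardShift e w B) (hw : ∀ n, 0 < w n)
    {c ρ : ℝ} (hc : 0 < c) (hρ : 0 < ρ) (hP : ∀ n, c * (ρ⁻¹) ^ n ≤ weightProd w n)
    {σ : ℝ} (hσ : ρ < σ) (a : ℕ →₀ ℂ) :
    ∃ L : ℕ, ∀ r ≥ L, ‖fwd e w r a‖ ≤ σ ^ r ∧ (B ^ r) (fwd e w 0 a) = 0 := by
  obtain ⟨M, hM⟩ := exists_norm_fwd_le (e := e) hw hc hρ hP a
  obtain ⟨N, hN⟩ := hB.exists_pow_fwd_eq_zero a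
  have hσ0 : 0 < σ := hρ.trans hσ
  have ht : Tendsto (fun r : ℕ => M * (ρ / σ) ^ r) atTop (𝓝 0) := by
    simpa using (tendsto_pow_atTop_nhds_zero_of_lt_one (by positivity)
      ((div_lt_one hσ0).2 hσ)).const_mul M
  obtain ⟨L, hL⟩ := eventually_atTop.1 (ht.eventually_le_const one_pos)
  refine ⟨max L N, fun r hr => ⟨(hM r).trans ?_, hN r ((le_max_right _ _).trans hr)⟩⟩
  have := hL r ((le_max_left _ _).trans hr)
  rw [div_pow, ← mul_div_assoc, div_le_one (by positivity)] at this
  exact this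

/-- The vector is the sum of `fwd e w n (a k)` over all `k` and all `n ∈ sepSet l k`. For `m ∈
sepSet l j`, the power `B ^ m` kills the terms with `n < m` and turns the term `n = m` into `a j`.
The later terms start at distance `l j` and add up to at most `σ ^ l j / (1 - σ)`. -/
theorem IsBackwardShift.isFrequentlyHypercyclic [CompleteSpace H]
    (hB : IsBackwardShift e w B) (hw : ∀ n, 0 < w n) {c ρ : ℝ} (hc : 0 < c) (hρ : 0 < ρ) (hρ1 : ρ < 1)
    (hP : ∀ n, c * (ρ⁻¹) ^ n ≤ weightProd w n) : IsFrequentlyHypercyclic B := by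
  classical
  have := secondCountable_of_hilbertBasis e
  obtain ⟨t, htr, htc, htd⟩ :=
    (denseRange_fwd_zero e hw).exists_countable_dense_subset
  obtain ⟨s, rfl⟩ := htc.exists_eq_range htd.nonempty
  choose b hb using fun n => htr (mem_range_self n)
  -- Unpairing repeats each dense vector infinitely often, so the error `σ ^ l j / (1 - σ)` can be
  -- made small for every target.
  set a : ℕ → (ℕ →₀ ℂ) := fun j => b (Nat.unpair j).1
  obtain ⟨σ, hρσ, hσ1⟩ := exists_between hρ1
  have hσ0 : 0 < σ := hρ.trans hρσ
  choose L hL using fun j => exists_fwd_bounds hB hw hc hρ hP hρσ (a j)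
  set l : ℕ → ℕ := fun j => ∑ i ∈ Finset.range (j + 1), (L i + 1)
  have hlmono : Monotone l := monotone_nat_of_le_succ fun j => by
    simp only [l]
    rw [Finset.sum_range_succ _ (j + 1)]
    exact Nat.le_add_right _ _
  have hLl : ∀ j, L j ≤ l j := fun j => by
    have := Finset.single_le_sum (f := fun i => L i + 1) (fun i _ => Nat.zero_le _)
      (Finset.self_mem_range_succ j)
    simp only [l]
    omega
  have hjl : ∀ j, j + 1 ≤ l j := fun j => by
    have := Finset.card_nsmul_le_sum (Finset.range (j + 1)) (fun i => L i + 1) 1 (by simp)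
    simpa [l] using this
  have hl1 : ∀ j, 1 ≤ l j := fun j => by have := hjl j; omega
  have hLl' : ∀ j, ∀ r ≥ l j, ‖fwd e w r (a j)‖ ≤ σ ^ r ∧ (B ^ r) (fwd e w 0 (a j)) = 0 :=
    fun j r hr => hL j r ((hLl j).trans hr)
  obtain ⟨u, hu1, hu2⟩ : ∃ u : ℕ → H, (∀ k, ∀ n ∈ sepSet l k, u n = fwd e w n (a k)) ∧
      ∀ n, (∀ k, n ∉ sepSet l k) → u n = 0 := by
    refine ⟨fun n => if h : ∃ k, n ∈ sepSet l k then fwd e w n (a h.choose) else 0, ?_, ?_⟩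
    · intro k n hn
      have h : ∃ k, n ∈ sepSet l k := ⟨k, hn⟩
      simp only [dif_pos h]
      have : h.choose = k := by
        by_contra hne
        have := sepSet_separated hl1 hlmono h.choose_spec hn (by simpa using hne)
        have := hl1 h.choose
        omega
      rw [this]
    · intro n hn
      have h : ¬ ∃ k, n ∈ sepSet l k := by simpa using hn
      simp only [dif_neg h]
  have hgeo := summable_geometric_of_lt_one hσ0.le hσ1
  have hus : Summable u := by
    refine Summable.of_norm_bounded hgeo fun n => ?_
    by_cases h : ∃ k, n ∈ sepSet l k
    · obtain ⟨k, hk⟩ := h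
      rw [hu1 k n hk]
      exact (hLl' k n (le_of_mem_sepSet hl1 hk)).1
    · rw [hu2 n (by simpa using h), norm_zero]
      positivity
  have hclose : ∀ j, ∀ m ∈ sepSet l j,
      ‖(B ^ m) (∑' n, u n) - fwd e w 0 (a j)‖ ≤ σ ^ (l j) * (1 - σ)⁻¹ := by
    intro j m hm
    have hfin : ∑ n ∈ Finset.range (m + l j), (B ^ m) (u n) = fwd e w 0 (a j) := by
      rw [Finset.sum_eq_single m]
      · rw [hu1 j m hm]
        have := hB.pow_fwd hw m 0 (a j)
        rwa [add_zero] at this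
      · intro n hn hnm
        rw [Finset.mem_range] at hn
        by_cases h : ∃ k, n ∈ sepSet l k
        · obtain ⟨k, hk⟩ := h
          have h1 := sepSet_separated hl1 hlmono hk hm (by simp [hnm])
          have h2 := sepSet_separated hl1 hlmono hm hk (by simp [Ne.symm hnm])
          have h3 : n + l k ≤ m := by
            have := hl1 j
            omega
          rw [hu1 k n hk]
          obtain ⟨d, rfl⟩ := Nat.exists_eq_add_of_le ((Nat.le_add_right _ _).trans h3)
          have h4 := hB.pow_fwd hw n 0 (a k)
          rw [add_zero] at h4
          rw [add_comm n d, pow_add, mul_apply_eq_comp, h4]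
          exact (hLl' k d (by omega)).2
        · rw [hu2 n (by simpa using h), map_zero]
      · intro h
        refine absurd (Finset.mem_range.2 ?_) h
        have := hl1 j
        omega
    have hBs := hus.mapL (B ^ m)
    rw [(B ^ m).map_tsum hus, ← hBs.sum_add_tsum_nat_add (m + l j), hfin, add_sub_cancel_left]
    refine tsum_of_norm_bounded ((hasSum_geometric_of_lt_one hσ0.le hσ1).mul_left _) fun i => ?_
    rw [← pow_add]
    by_cases h : ∃ k, i + (m + l j) ∈ sepSet l k
    · obtain ⟨k, hk⟩ := h
      have h1 := sepSet_separated hl1 hlmono hk hm (by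
        have := hl1 j
        simp only [ne_eq, Prod.mk.injEq, not_and]
        omega)
      have h2 := hl1 j
      rw [hu1 k _ hk, show i + (m + l j) = m + (l j + i) by ring, hB.pow_fwd hw]
      exact (hLl' k _ (by omega)).1
    · rw [hu2 _ (by simpa using h), map_zero, norm_zero]
      positivity
  refine ⟨∑' n, u n, fun G hG hGne => ?_⟩
  obtain ⟨y, hy⟩ := hGne
  obtain ⟨ε, hε, hball⟩ := Metric.isOpen_iff.1 hG y hy
  obtain ⟨_, ⟨k, rfl⟩, hk⟩ := htd.exists_mem_open Metric.isOpen_ball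
    ⟨y, Metric.mem_ball_self (half_pos hε)⟩
  have ht : Tendsto (fun n : ℕ => σ ^ n * (1 - σ)⁻¹) atTop (𝓝 0) := by
    simpa using (tendsto_pow_atTop_nhds_zero_of_lt_one hσ0.le hσ1).mul_const (1 - σ)⁻¹
  obtain ⟨n, hn⟩ := (ht.eventually_lt_const (half_pos hε)).exists
  set j := Nat.pair k n
  have haj : fwd e w 0 (a j) = s k := by simp [a, j, hb]
  have hnl : n ≤ l j := (Nat.right_le_pair k n).trans ((Nat.le_succ _).trans (hjl j))
  refine (lowerDensity_pos_of_le (S := sepSet l j) ?_ fun N => sepSet_card hl1 j N).trans_le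
    (lowerDensity_mono fun m hm => hball ?_)
  · have := period_pos hl1 j
    positivity
  · have h1 := hclose j m hm
    have h2 : σ ^ (l j) * (1 - σ)⁻¹ ≤ σ ^ n * (1 - σ)⁻¹ :=
      mul_le_mul_of_nonneg_right (pow_le_pow_of_le_one hσ0.le hσ1.le hnl)
        (inv_nonneg.2 (by linarith))
    rw [haj] at h1
    rw [Metric.mem_ball, dist_eq_norm] at hk ⊢
    calc ‖(B ^ m) (∑' n, u n) - y‖ ≤ ‖(B ^ m) (∑' n, u n) - s k‖ + ‖s k - y‖ :=
          norm_sub_le_norm_sub_add_norm_sub _ _ _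
      _ < ε := by linarith

end Operator

/-! ### Means along an ultrafilter -/

/-- The averages of `φ` over `[1, N]` converge to `c` along a fixed free ultrafilter. -/
def HasMean (φ : ℕ → ℝ) (c : ℝ) : Prop :=
  Tendsto (fun N : ℕ => (∑ m ∈ Finset.Icc 1 N, φ m) / N) (hyperfilter ℕ : Filter ℕ) (𝓝 c)

theorem hyperfilter_le_atTop : (hyperfilter ℕ : Filter ℕ) ≤ atTop := by
  rw [← Nat.cofinite_eq_atTop]
  exact hyperfilter_le_cofinite

/-- Limits along an ultrafilter exist for all bounded averages at once and are additive, unlike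
upper and lower densities. -/
theorem exists_hasMean {φ : ℕ → ℝ} (h0 : ∀ m, 0 ≤ φ m) (h1 : ∀ m, φ m ≤ 1) :
    ∃ c, HasMean φ c ∧ 0 ≤ c := by
  have hmem : ∀ N : ℕ, (∑ m ∈ Finset.Icc 1 N, φ m) / N ∈ Set.Icc (0 : ℝ) 1 := by
    intro N
    refine ⟨div_nonneg (Finset.sum_nonneg fun m _ => h0 m) N.cast_nonneg,
      div_le_one_of_le₀ ?_ N.cast_nonneg⟩
    have := Finset.sum_le_card_nsmul (Finset.Icc 1 N) φ 1 fun m _ => h1 m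
    simpa using this
  obtain ⟨c, hc, hle⟩ := isCompact_Icc.ultrafilter_le_nhds
    ((hyperfilter ℕ).map fun N : ℕ => (∑ m ∈ Finset.Icc 1 N, φ m) / N)
    (le_principal_iff.2 (Ultrafilter.mem_map.2 (univ_mem' hmem)))
  exact ⟨c, hle, hc.1⟩

namespace HasMean

variable {φ ψ : ℕ → ℝ} {a b : ℝ}

theorem const (a : ℝ) : HasMean (fun _ => a) a := by
  refine (tendsto_const_nhds.congr' ?_).mono_left hyperfilter_le_atTop
  filter_upwards [eventually_gt_atTop 0] with N hN
  have : (N : ℝ) ≠ 0 := by exact_mod_cast hN.ne'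
  simp [this]

theorem add (hφ : HasMean φ a) (hψ : HasMean ψ b) : HasMean (fun m => φ m + ψ m) (a + b) := by
  refine (Tendsto.add hφ hψ).congr fun N => ?_
  rw [Finset.sum_add_distrib, add_div]

theorem const_mul (t : ℝ) (hφ : HasMean φ a) : HasMean (fun m => t * φ m) (t * a) := by
  refine (Tendsto.const_mul t hφ).congr fun N => ?_
  rw [← Finset.mul_sum, mul_div_assoc]

theorem sum {ι : Type*} (s : Finset ι) {φ : ι → ℕ → ℝ} {a : ι → ℝ}
    (h : ∀ i ∈ s, HasMean (φ i) (a i)) : HasMean (fun m => ∑ i ∈ s, φ i m) (∑ i ∈ s, a i) := by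
  refine (tendsto_finsetSum s h).congr fun N => ?_
  rw [Finset.sum_comm, Finset.sum_div]

theorem le (hφ : HasMean φ a) (hψ : HasMean ψ b) (h : ∀ m, φ m ≤ ψ m) : a ≤ b :=
  le_of_tendsto_of_tendsto' hφ hψ fun N => by
    gcongr
    exact h _

/-- Shifting by one changes the average over `[1, N]` only by boundary terms, of size at most `1 /
N`. -/
theorem shift (hφ : HasMean φ a) (h0 : ∀ m, 0 ≤ φ m) (h1 : ∀ m, φ m ≤ 1) (s : ℕ) :
    HasMean (fun m => φ (m + s)) a := by
  induction s with
  | zero => exact hφ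
  | succ s ih =>
    have hz : Tendsto (fun N : ℕ => (φ (N + 1 + s) - φ (1 + s)) / (N : ℝ)) (hyperfilter ℕ : Filter ℕ)
        (𝓝 0) := by
      refine Tendsto.mono_left ?_ hyperfilter_le_atTop
      refine squeeze_zero_norm (fun N => ?_) tendsto_one_div_atTop_nhds_zero_nat
      rw [norm_div, Real.norm_natCast]
      gcongr
      rw [Real.norm_eq_abs, abs_le]
      constructor <;> linarith [h0 (N + 1 + s), h1 (N + 1 + s), h0 (1 + s), h1 (1 + s)]
    have := Tendsto.add ih hz
    rw [add_zero] at this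
    refine this.congr fun N => ?_
    rw [← add_div]
    congr 1
    induction N with
    | zero => simp
    | succ N ihN =>
      rw [Finset.sum_Icc_succ_top (by omega), Finset.sum_Icc_succ_top (by omega), ← ihN,
        show N + 1 + (s + 1) = N + 1 + 1 + s by ring]
      ring

end HasMean

/-- The indicator function of a set of natural numbers. -/
def ind (S : Set ℕ) : ℕ → ℝ := S.indicator 1

theorem ind_nonneg (S : Set ℕ) (m : ℕ) : 0 ≤ ind S m :=
  Set.indicator_nonneg (fun _ _ => zero_le_one) m

theorem ind_le_one (S : Set ℕ) (m : ℕ) : ind S m ≤ 1 :=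
  Set.indicator_le_self' (fun _ _ => zero_le_one) m

theorem ind_mul_self (S : Set ℕ) (m : ℕ) : ind S m * ind S m = ind S m := by
  by_cases h : m ∈ S <;> simp [ind, h]

theorem ind_mul_nonneg (S : Set ℕ) (k m : ℕ) : 0 ≤ ind S m * ind S (m + k) :=
  mul_nonneg (ind_nonneg S _) (ind_nonneg S _)

theorem ind_mul_le_one (S : Set ℕ) (k m : ℕ) : ind S m * ind S (m + k) ≤ 1 :=
  mul_le_one₀ (ind_le_one S _) (ind_nonneg S _) (ind_le_one S _)

theorem exists_hasMean_ind_pos {S : Set ℕ} (hS : 0 < lowerDensity S) :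
    ∃ d, 0 < d ∧ HasMean (ind S) d := by
  classical
  obtain ⟨d, hd, -⟩ := exists_hasMean (ind_nonneg S) (ind_le_one S)
  refine ⟨d, (half_pos hS).trans_le ?_, hd⟩
  have hev : ∀ᶠ n : ℕ in atTop, lowerDensity S / 2 < ((S ∩ Set.Icc 1 n).ncard : ℝ) / n :=
    eventually_lt_of_lt_liminf (half_lt_self hS) (isBoundedUnder_of ⟨0, fun n => by positivity⟩)
  refine ge_of_tendsto hd (hyperfilter_le_atTop (hev.mono fun n hn => ?_))
  have : ((S ∩ Set.Icc 1 n).ncard : ℝ) = ∑ m ∈ Finset.Icc 1 n, ind S m := by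
    have h1 : S ∩ Set.Icc 1 n = ((Finset.Icc 1 n).filter (· ∈ S) : Finset ℕ) := by
      ext m; simp only [mem_inter_iff, Set.mem_Icc, Finset.coe_filter, Finset.mem_Icc,
        mem_ofPred_eq]; tauto
    rw [h1, Set.ncard_coe_finset, Finset.card_filter]
    push_cast
    refine Finset.sum_congr rfl fun m _ => ?_
    by_cases h : m ∈ S <;> simp [ind, h]
  rw [← this]
  exact hn.le

/-- The return times of a set of positive lower density form a syndetic set. -/
theorem exists_correlation_ge {S : Set ℕ} (hS : 0 < lowerDensity S) {c : ℕ → ℝ}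
    (hc : ∀ k, HasMean (fun m => ind S m * ind S (m + k)) (c k)) :
    ∃ δ > 0, ∃ f : ℕ, ∀ n, ∃ a ≤ f, δ ≤ c (n + a) := by
  obtain ⟨d, hd, hdm⟩ := exists_hasMean_ind_pos hS
  refine ⟨d ^ 2 / 2, by positivity, ?_⟩
  by_contra! hcon
  choose g hg using hcon
  -- If long gaps without good correlations existed, each new point could be placed so that its
  -- differences with all earlier points lie in such a gap. All pairwise correlations of the shifted
  -- sets are then below `d ^ 2 / 2`.
  let s : ℕ → ℕ := fun i => Nat.rec 0 (fun _ x => g x + x) i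
  have hs : ∀ i, s (i + 1) = g (s i) + s i := fun i => rfl
  have hmono : Monotone s := monotone_nat_of_le_succ fun i => by rw [hs]; omega
  have hlt : ∀ i j, i < j → c (s j - s i) < d ^ 2 / 2 := by
    intro i j hij
    obtain ⟨j, rfl⟩ := Nat.exists_eq_succ_of_ne_zero (Nat.ne_zero_of_lt hij)
    have h1 := hmono (Nat.lt_succ_iff.1 hij)
    rw [Nat.succ_eq_add_one, hs, Nat.add_sub_assoc h1]
    exact hg _ _ (Nat.sub_le _ _)
  have hpair : ∀ i j, i ≠ j →
      ∃ q, q ≤ d ^ 2 / 2 ∧ HasMean (fun m => ind S (m + s i) * ind S (m + s j)) q := by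
    have key : ∀ i j, i < j →
        ∃ q, q ≤ d ^ 2 / 2 ∧ HasMean (fun m => ind S (m + s i) * ind S (m + s j)) q := by
      intro i j hij
      refine ⟨_, (hlt i j hij).le, ?_⟩
      have h := (hc (s j - s i)).shift (ind_mul_nonneg S _) (ind_mul_le_one S _) (s i)
      have h1 := hmono hij.le
      refine (congrArg (fun φ => HasMean φ _) (funext fun m => ?_)).mp h
      rw [show m + s i + (s j - s i) = m + s j by omega]
    intro i j hij
    rcases lt_or_gt_of_ne hij with h | h
    · exact key i j h
    · obtain ⟨q, hq, hm⟩ := key j i h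
      exact ⟨q, hq, by simpa only [mul_comm] using hm⟩
  have hpair' : ∀ i j, ∃ q, q ≤ d ^ 2 / 2 + (if i = j then d else 0) ∧
      HasMean (fun m => ind S (m + s i) * ind S (m + s j)) q := by
    intro i j
    by_cases hij : i = j
    · subst hij
      refine ⟨d, by rw [if_pos rfl]; nlinarith, ?_⟩
      simp only [ind_mul_self]
      exact hdm.shift (ind_nonneg S) (ind_le_one S) _
    · obtain ⟨q, hq, hm⟩ := hpair i j hij
      exact ⟨q, by simpa [hij] using hq, hm⟩
  choose q hq hqm using hpair'
  obtain ⟨r, hr⟩ := exists_nat_gt (2 / d)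
  rw [div_lt_iff₀ hd] at hr
  -- Averaging `(∑ i, ind S (m + s i) - r * d) ^ 2 ≥ 0` over `m` bounds `(r * d) ^ 2` by the sum of
  -- the correlations, hence by `(r * d) ^ 2 / 2 + r * d`. This fails since `r * d > 2`.
  have h1 := (((HasMean.sum (Finset.range r) fun i _ =>
    hdm.shift (ind_nonneg S) (ind_le_one S) (s i)).const_mul (2 * (r * d))).add
      (HasMean.const (-(r * d) ^ 2)))
  have h2 := HasMean.sum (Finset.range r) fun i _ =>
    HasMean.sum (Finset.range r) fun j _ => hqm i j
  have h3 := h1.le h2 fun m => by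
    rw [← Finset.sum_mul_sum]
    nlinarith [sq_nonneg ((∑ i ∈ Finset.range r, ind S (m + s i)) - r * d)]
  have h4 : ∑ i ∈ Finset.range r, ∑ j ∈ Finset.range r, q i j
      ≤ ∑ i ∈ Finset.range r, ∑ j ∈ Finset.range r, (d ^ 2 / 2 + (if i = j then d else 0)) :=
    Finset.sum_le_sum fun i _ => Finset.sum_le_sum fun j _ => hq i j
  have h5 : ∑ i ∈ Finset.range r, ∑ j ∈ Finset.range r, (d ^ 2 / 2 + (if i = j then d else 0))
      = r * (r * (d ^ 2 / 2)) + r * d := by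
    simp only [Finset.sum_add_distrib, Finset.sum_const, Finset.card_range, nsmul_eq_mul]
    congr 1
    rw [Finset.sum_congr rfl fun i hi => Finset.sum_ite_eq (Finset.range r) i fun _ => d]
    rw [Finset.sum_congr rfl fun i hi => if_pos hi]
    simp
  rw [h5] at h4
  simp only [Finset.sum_const, Finset.card_range, nsmul_eq_mul] at h3
  have hrd : 0 < r * d := by linarith
  nlinarith

/-! ### Frequent hypercyclicity forces the weight products to diverge. -/

section Operator

variable {H : Type*} [NormedAddCommGroup H] [InnerProductSpace ℂ H]
variable {e : HilbertBasis ℕ ℂ H} {w : ℕ → ℝ} {B : H →L[ℂ] H}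

/-- Let `S` be the times at which the orbit is near `e 0`. If `m` and `m + k` lie in `S`, the `k`-th
coordinate of `B ^ m x` is at least `1 / (2 P_k)`. Bessel's inequality and averaging over `m` make
`∑ k, c k / P_k ^ 2` finite. As `c k ≥ δ` on a syndetic set, `P_k` diverges there, and bounded gaps
extend this to all indices. -/
theorem IsBackwardShift.not_isFrequentlyHypercyclic (hB : IsBackwardShift e w B)
    (hw : ∀ n, 0 < w n) {C : ℝ} (hC : ∀ n, w n ≤ C)
    (hP : ¬ Tendsto (weightProd w) atTop atTop) : ¬ IsFrequentlyHypercyclic B := by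
  rintro ⟨x, hx⟩
  set S : Set ℕ := {k | (B ^ k) x ∈ Metric.ball (e 0) (1 / 2)} with hSdef
  have hS : 0 < lowerDensity S := hx _ Metric.isOpen_ball ⟨e 0, by simp⟩
  choose c hc hc0 using fun k => exists_hasMean (ind_mul_nonneg S k) (ind_mul_le_one S k)
  obtain ⟨δ, hδ, f, hf⟩ := exists_correlation_ge hS hc
  have hpos := weightProd_pos hw
  have hlow : ∀ k ∈ S, 1 / 2 ≤ weightProd w k * ‖e.repr x k‖ := by
    intro k hk
    have hk' : ‖(B ^ k) x - e 0‖ < 1 / 2 := by rw [← mem_ball_iff_norm]; exact hk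
    have h1 := (norm_repr_le e ((B ^ k) x - e 0) 0).trans hk'.le
    rw [e.repr_apply_apply, inner_sub_right, ← e.repr_apply_apply, ← e.repr_apply_apply,
      repr_basis_self, hB.repr_pow_zero] at h1
    have h2 := norm_sub_norm_le (1 : ℂ) (weightProd w k * e.repr x k)
    rw [norm_one, norm_mul, Complex.norm_real, Real.norm_of_nonneg (hpos k).le,
      norm_sub_rev] at h2
    linarith
  -- The constant is `4 * (3 / 2) ^ 2`, with `3 / 2` bounding the norm in the ball around `e 0`.
  have hpt : ∀ (F : Finset ℕ) (m : ℕ),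
      ∑ k ∈ F, (weightProd w k ^ 2)⁻¹ * (ind S m * ind S (m + k)) ≤ 9 := by
    intro F m
    by_cases hm : m ∈ S
    · have h1 : ∀ k ∈ F, (weightProd w k ^ 2)⁻¹ * (ind S m * ind S (m + k))
          ≤ 4 * ‖inner ℂ (e k) ((B ^ m) x)‖ ^ 2 := by
        intro k _
        by_cases hk : m + k ∈ S
        · have h2 := hlow _ hk
          have h3 := congrArg norm (hB.repr_pow m k x)
          rw [norm_mul, norm_mul, Complex.norm_real, Complex.norm_real,
            Real.norm_of_nonneg (hpos _).le, Real.norm_of_nonneg (hpos _).le,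
            add_comm k m] at h3
          rw [← h3, e.repr_apply_apply] at h2
          simp only [ind, Set.indicator_of_mem hm, Set.indicator_of_mem hk, Pi.one_apply, mul_one]
          have h4 := hpos k
          rw [inv_le_iff_one_le_mul₀ (by positivity)]
          nlinarith
        · simp only [ind, Set.indicator_of_notMem hk, mul_zero]
          positivity
      refine (Finset.sum_le_sum h1).trans ?_
      rw [← Finset.mul_sum]
      have h2 := e.orthonormal.sum_inner_products_le ((B ^ m) x) (s := F)
      have h3 : ‖(B ^ m) x‖ ≤ 3 / 2 := by
        have h4 : ‖(B ^ m) x - e 0‖ < 1 / 2 := by rw [← mem_ball_iff_norm]; exact hm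
        have h5 := norm_le_norm_sub_add ((B ^ m) x) (e 0)
        rw [e.orthonormal.1] at h5
        linarith
      nlinarith [norm_nonneg ((B ^ m) x)]
    · simp [ind, hm]
  have hsum : Summable fun k => (weightProd w k ^ 2)⁻¹ * c k := by
    refine summable_of_sum_le (c := 9) (fun k => mul_nonneg (by positivity) (hc0 k)) fun F => ?_
    exact (HasMean.sum F fun k _ => (hc k).const_mul (weightProd w k ^ 2)⁻¹).le
      (HasMean.const 9) (hpt F)
  refine hP (tendsto_atTop.2 fun K => ?_)
  have hC1 : ∀ n, w n ≤ max C 1 := fun n => (hC n).trans (le_max_left C 1)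
  set D := max C 1 ^ f * (|K| + 1) with hD
  have hDpos : 0 < D := by positivity
  obtain ⟨N, hN⟩ := eventually_atTop.1
    (hsum.tendsto_atTop_zero.eventually_lt_const (show 0 < (D ^ 2)⁻¹ * δ by positivity))
  filter_upwards [eventually_ge_atTop N] with n hn
  obtain ⟨a, haf, ha⟩ := hf n
  by_contra! hlt
  have h1 := hN (n + a) (hn.trans (Nat.le_add_right _ _))
  have h2 : weightProd w (n + a) ≤ D := by
    refine (weightProd_add_le hw hC1 n a).trans ?_
    have h3 : max C 1 ^ a ≤ max C 1 ^ f := pow_le_pow_right₀ (le_max_right _ _) haf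
    exact mul_le_mul h3 (by linarith [le_abs_self K]) (hpos n).le (by positivity)
  have h3 : (D ^ 2)⁻¹ ≤ (weightProd w (n + a) ^ 2)⁻¹ := by
    have := hpos (n + a)
    gcongr
  have h4 : (D ^ 2)⁻¹ * δ ≤ (weightProd w (n + a) ^ 2)⁻¹ * c (n + a) :=
    mul_le_mul h3 ha hδ.le (by have := hpos (n + a); positivity)
  linarith

end Operator

/-! ### Random walks: growth, boundedness and the centred case. -/

section Probability

variable {Ω : Type*} {ξ : ℕ → Ω → ℝ}

/-- The partial sums of a sequence of random variables. -/
def partialSum (ξ : ℕ → Ω → ℝ) (n : ℕ) (ω : Ω) : ℝ := ∑ i ∈ Finset.range n, ξ i ω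

theorem partialSum_succ (ξ : ℕ → Ω → ℝ) (n : ℕ) (ω : Ω) :
    partialSum ξ (n + 1) ω = partialSum ξ n ω + ξ n ω := Finset.sum_range_succ _ _

/-- After time `k` the walk stays more than `δ` above its position at time `k`. -/
def escapeSet (ξ : ℕ → Ω → ℝ) (δ : ℝ) (k : ℕ) : Set Ω :=
  {ω | ∀ m, δ < ∑ i ∈ Finset.range (m + 1), ξ (k + i) ω}

theorem lt_partialSum_of_mem_escapeSet {δ : ℝ} {k m : ℕ} {ω : Ω} (h : ω ∈ escapeSet ξ δ k)
    (hm : k < m) : partialSum ξ k ω + δ < partialSum ξ m ω := by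
  obtain ⟨d, rfl⟩ := Nat.exists_eq_add_of_lt hm
  have := h d
  rw [partialSum, partialSum, add_assoc, Finset.sum_range_add]
  linarith

open scoped Classical in
-- The walk gains more than `δ` after each escape time, so many escape times mean a large total
-- increment.
theorem exists_card_escape_le {δ : ℝ} (ω : Ω) (n : ℕ) :
    ∃ j ≤ n, δ * ((Finset.range n).filter fun k => ω ∈ escapeSet ξ δ k).card
      ≤ partialSum ξ n ω - partialSum ξ j ω := by
  -- In the second alternative `j` is the first escape time; the bound for all `m ≥ n` is what the
  -- induction carries.
  have key : ∃ j ≤ n, ((Finset.range n).filter fun k => ω ∈ escapeSet ξ δ k).card = 0 ∨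
      ∀ m ≥ n, δ * ((Finset.range n).filter fun k => ω ∈ escapeSet ξ δ k).card
        ≤ partialSum ξ m ω - partialSum ξ j ω := by
    induction n with
    | zero => exact ⟨0, le_rfl, Or.inl (by simp)⟩
    | succ n ih =>
      obtain ⟨j, hj, ih⟩ := ih
      rw [Finset.range_add_one, Finset.filter_insert]
      by_cases hn : ω ∈ escapeSet ξ δ n
      · rw [if_pos hn, Finset.card_insert_of_notMem (by simp)]
        rcases ih with ih | ih
        · refine ⟨n, Nat.le_succ n, Or.inr fun m hm => ?_⟩
          have := lt_partialSum_of_mem_escapeSet hn hm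
          rw [ih]
          push_cast
          linarith
        · refine ⟨j, hj.trans (Nat.le_succ n), Or.inr fun m hm => ?_⟩
          have h1 := lt_partialSum_of_mem_escapeSet hn hm
          have h2 := ih n le_rfl
          push_cast
          linarith
      · rw [if_neg hn]
        refine ⟨j, hj.trans (Nat.le_succ n), ih.imp_right fun ih m hm => ih m ?_⟩
        omega
  obtain ⟨j, hj, h | h⟩ := key
  · exact ⟨n, le_rfl, by rw [h]; simp⟩
  · exact ⟨j, hj, h n le_rfl⟩

variable [MeasurableSpace Ω] {μ : Measure Ω}

/-! ### Consequences of the strong law of large numbers -/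

theorem ae_tendsto_partialSum_div (hint : Integrable (ξ 0) μ) (hindep : iIndepFun ξ μ)
    (hident : ∀ n, IdentDistrib (ξ n) (ξ 0) μ μ) :
    ∀ᵐ ω ∂μ, Tendsto (fun n : ℕ => partialSum ξ n ω / n) atTop (𝓝 (∫ ω, ξ 0 ω ∂μ)) :=
  strong_law_ae_real ξ hint (fun _ _ hij => hindep.indepFun hij) hident

theorem exists_linear_le {S : ℕ → ℝ} {c a : ℝ} (hS : Tendsto (fun n : ℕ => S n / n) atTop (𝓝 c))
    (ha : a < c) : ∃ b : ℝ, ∀ n : ℕ, a * n + b ≤ S n := by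
  obtain ⟨N, hN⟩ := eventually_atTop.1 (hS.eventually_const_lt ha)
  refine ⟨-∑ n ∈ Finset.range (N + 1), |S n - a * n|, fun n => ?_⟩
  by_cases hn : n < N + 1
  · have := Finset.single_le_sum (f := fun n : ℕ => |S n - a * n|) (fun i _ => abs_nonneg _)
      (Finset.mem_range.2 hn)
    have h2 := neg_abs_le (S n - a * n)
    linarith
  · have hn0 : (0 : ℝ) < n := by exact_mod_cast (by omega : 0 < n)
    have h1 := hN n (by omega)
    rw [lt_div_iff₀ hn0] at h1
    have h2 : 0 ≤ ∑ n ∈ Finset.range (N + 1), |S n - a * n| :=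
      Finset.sum_nonneg fun _ _ => abs_nonneg _
    linarith

theorem exists_le_linear {S : ℕ → ℝ} {c a : ℝ} (hS : Tendsto (fun n : ℕ => S n / n) atTop (𝓝 c))
    (ha : c < a) : ∃ b : ℝ, ∀ n : ℕ, S n ≤ a * n + b := by
  have h : Tendsto (fun n : ℕ => (-S n) / n) atTop (𝓝 (-c)) := by
    simpa only [neg_div] using hS.neg
  obtain ⟨b, hb⟩ := exists_linear_le h (neg_lt_neg ha)
  exact ⟨-b, fun n => by linarith [hb n]⟩

theorem ae_bddAbove_of_integral_neg (hint : Integrable (ξ 0) μ) (hindep : iIndepFun ξ μ)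
    (hident : ∀ n, IdentDistrib (ξ n) (ξ 0) μ μ) (hneg : ∫ ω, ξ 0 ω ∂μ < 0) :
    ∀ᵐ ω ∂μ, BddAbove (range fun n => partialSum ξ n ω) := by
  filter_upwards [ae_tendsto_partialSum_div hint hindep hident] with ω hω
  obtain ⟨b, hb⟩ := exists_le_linear hω hneg
  refine ⟨b, ?_⟩
  rintro _ ⟨n, rfl⟩
  simpa using hb n

theorem integrable_of_lintegral_ne_top {Y : Ω → ℝ} (hY : Measurable Y)
    (hpos : ∫⁻ ω, ENNReal.ofReal (Y ω) ∂μ ≠ ∞) (hneg : ∫⁻ ω, ENNReal.ofReal (-Y ω) ∂μ ≠ ∞) :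
    Integrable Y μ := by
  refine ⟨hY.aestronglyMeasurable, ?_⟩
  have h : ∀ ω, ‖Y ω‖ₑ ≤ ENNReal.ofReal (Y ω) + ENNReal.ofReal (-Y ω) := by
    intro ω
    rw [← ofReal_norm, Real.norm_eq_abs]
    rcases abs_choice (Y ω) with h | h <;> rw [h]
    · exact le_self_add
    · exact le_add_self
  refine (lintegral_mono h).trans_lt ?_
  rw [lintegral_add_left (by fun_prop)]
  exact ENNReal.add_lt_top.2 ⟨hpos.lt_top, hneg.lt_top⟩

/-- By monotone convergence the truncated negative parts have integrals tending to `∞`, so one of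
them exceeds the finite integral of the positive part. -/
theorem exists_truncation_integral_neg [IsFiniteMeasure μ] {Y : Ω → ℝ} (hY : Measurable Y)
    (hpos : ∫⁻ ω, ENNReal.ofReal (Y ω) ∂μ ≠ ∞) (hinf : ∫⁻ ω, ENNReal.ofReal (-Y ω) ∂μ = ∞) :
    ∃ M : ℝ, Integrable (fun ω => max (Y ω) (-M)) μ ∧ ∫ ω, max (Y ω) (-M) ∂μ < 0 := by
  have hsup : ⨆ n : ℕ, ∫⁻ ω, min (ENNReal.ofReal (-Y ω)) (n : ℝ≥0∞) ∂μ = ∞ := by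
    rw [← lintegral_iSup (f := fun (n : ℕ) ω => min (ENNReal.ofReal (-Y ω)) (n : ℝ≥0∞))
      (fun n => hY.neg.ennreal_ofReal.min measurable_const)
      (fun m n hmn ω => min_le_min_left _ (by exact_mod_cast hmn)), ← hinf]
    congr 1
    funext ω
    have := inf_iSup_eq (ENNReal.ofReal (-Y ω)) fun n : ℕ => (n : ℝ≥0∞)
    rw [ENNReal.iSup_natCast, inf_top_eq] at this
    exact this.symm
  obtain ⟨M, hM⟩ := lt_iSup_iff.1 (hsup ▸ hpos.lt_top)
  have h1 : ∀ ω, ENNReal.ofReal (max (Y ω) (-M)) = ENNReal.ofReal (Y ω) := by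
    intro ω
    rw [ENNReal.ofReal_max, ENNReal.ofReal_of_nonpos (show (-M : ℝ) ≤ 0 by simp)]
    simp
  have h2 : ∀ ω, ENNReal.ofReal (-max (Y ω) (-M)) = min (ENNReal.ofReal (-Y ω)) M := by
    intro ω
    rw [← min_neg_neg, neg_neg, ENNReal.ofReal_min, ENNReal.ofReal_natCast]
  have hfin : ∫⁻ ω, min (ENNReal.ofReal (-Y ω)) M ∂μ ≠ ∞ := by
    refine ne_top_of_le_ne_top ?_ (lintegral_mono fun ω => min_le_right _ _)
    rw [lintegral_const]
    exact ENNReal.mul_ne_top (ENNReal.natCast_ne_top M) (measure_ne_top μ _)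
  have hint : Integrable (fun ω => max (Y ω) (-(M : ℝ))) μ :=
    integrable_of_lintegral_ne_top (hY.max measurable_const) (by simpa only [h1] using hpos)
      (by simpa only [h2] using hfin)
  refine ⟨M, hint, ?_⟩
  rw [integral_eq_lintegral_pos_part_sub_lintegral_neg_part hint]
  simp only [h1, h2]
  rw [sub_neg]
  exact (ENNReal.toReal_lt_toReal hpos hfin).2 hM

/-- When the mean is `-∞`, the walk is dominated by the one with truncated steps, whose mean is
finite and negative. -/
theorem ae_bddAbove_of_eExpectation_neg [IsProbabilityMeasure μ] (hmeas : ∀ n, Measurable (ξ n))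
    (hindep : iIndepFun ξ μ) (hident : ∀ n, IdentDistrib (ξ n) (ξ 0) μ μ)
    (hpos : ∫⁻ ω, ENNReal.ofReal (ξ 0 ω) ∂μ ≠ ∞) (hneg : eExpectation (ξ 0) μ < 0) :
    ∀ᵐ ω ∂μ, BddAbove (range fun n => partialSum ξ n ω) := by
  by_cases hint : Integrable (ξ 0) μ
  · rw [eExpectation_eq_integral hint] at hneg
    exact ae_bddAbove_of_integral_neg hint hindep hident (by exact_mod_cast hneg)
  · have hinf : ∫⁻ ω, ENNReal.ofReal (-ξ 0 ω) ∂μ = ∞ := by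
      by_contra hne
      exact hint (integrable_of_lintegral_ne_top (hmeas 0) hpos hne)
    obtain ⟨M, hM, hMneg⟩ := exists_truncation_integral_neg (hmeas 0) hpos hinf
    have hφ : Measurable fun x : ℝ => max x (-M) := by fun_prop
    filter_upwards [ae_bddAbove_of_integral_neg (ξ := fun n ω => max (ξ n ω) (-M)) hM
      (hindep.comp (fun _ => fun x : ℝ => max x (-M)) fun _ => hφ)
      (fun n => (hident n).comp hφ) hMneg] with ω hω
    refine hω.range_mono _ fun n => ?_
    exact Finset.sum_le_sum fun i _ => le_max_left _ _

/-! ### Runs -/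

/-- Events on disjoint blocks of length `L` are independent with the same positive probability, so
the second Borel–Cantelli lemma applies. -/
theorem ae_frequently_run [IsProbabilityMeasure μ] (hmeas : ∀ n, Measurable (ξ n))
    (hindep : iIndepFun ξ μ) (hident : ∀ n, IdentDistrib (ξ n) (ξ 0) μ μ) {A : Set ℝ}
    (hA : MeasurableSet A) (hpos : μ (ξ 0 ⁻¹' A) ≠ 0) (L : ℕ) :
    ∀ᵐ ω ∂μ, ∃ᶠ j in atTop, ∀ i < L, ξ (j * L + i) ω ∈ A := by
  classical
  let E : ℕ → Set Ω := fun j => ⋂ i ∈ Finset.range L, ξ (j * L + i) ⁻¹' A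
  have hAn : ∀ n, μ (ξ n ⁻¹' A) = μ (ξ 0 ⁻¹' A) := fun n =>
    (hident n).measure_mem_eq hA
  have hEm : ∀ j, MeasurableSet (E j) := fun j =>
    Finset.measurableSet_biInter _ fun i _ => hmeas _ hA
  have hinj : ∀ j, Function.Injective fun i => j * L + i := fun j => add_right_injective _
  have hEmeas : ∀ j, μ (E j) = μ (ξ 0 ⁻¹' A) ^ L := by
    intro j
    have h := (hindep.precomp (hinj j)).meas_biInter (S := Finset.range L)
      (s := fun i => ξ (j * L + i) ⁻¹' A) fun i _ => ⟨A, hA, rfl⟩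
    simp only [E]
    rw [h]
    simp [hAn]
  have hind : iIndepSet E μ := by
    rw [iIndepSet_iff_meas_biInter hEm]
    intro s
    have h1 : ⋂ j ∈ s, E j = ⋂ n ∈ s.biUnion fun j => (Finset.range L).image fun i => j * L + i,
        ξ n ⁻¹' A := by
      ext ω
      simp only [E, mem_iInter, Finset.mem_biUnion, Finset.mem_image, Finset.mem_range]
      constructor
      · rintro h n ⟨j, hj, i, hi, rfl⟩
        exact h j hj i hi
      · intro h j hj i hi
        exact h _ ⟨j, hj, i, hi, rfl⟩
    rw [h1, hindep.meas_biInter fun i _ => ⟨A, hA, rfl⟩, Finset.prod_biUnion]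
    · refine Finset.prod_congr rfl fun j _ => ?_
      rw [Finset.prod_image fun a _ b _ h => hinj j h, hEmeas]
      simp [hAn]
    · intro j _ k _ hjk
      refine Finset.disjoint_left.2 fun n hn hn' => hjk ?_
      simp only [Finset.mem_image, Finset.mem_range] at hn hn'
      obtain ⟨i, hi, rfl⟩ := hn
      obtain ⟨i', hi', h⟩ := hn'
      have h2 : ∀ j i, i < L → (j * L + i) / L = j := fun j i hi => by
        rw [mul_comm, Nat.mul_add_div (by omega), Nat.div_eq_of_lt hi, add_zero]
      rw [← h2 j i hi, ← h2 k i' hi', h]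
  have hsum : ∑' j, μ (E j) = ∞ := by
    simp only [hEmeas]
    exact ENNReal.tsum_const_eq_top_of_ne_zero (pow_ne_zero _ hpos)
  have hlim := measure_limsup_eq_one hEm hind hsum
  have hlim' : ∀ᵐ ω ∂μ, ω ∈ limsup E atTop :=
    (prob_compl_eq_zero_iff (MeasurableSet.measurableSet_limsup hEm)).2 hlim
  filter_upwards [hlim'] with ω hω
  refine (mem_limsup_iff_frequently_mem.1 hω).mono fun j hj i hi => ?_
  exact mem_iInter₂.1 hj i (Finset.mem_range.2 hi)

/-! ### Centred random walks -/

/-- The index is `n + 1` because the natural filtration at time `n` already contains `ξ n`. -/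
theorem martingale_partialSum [IsProbabilityMeasure μ] (hmeas : ∀ n, Measurable (ξ n))
    (hindep : iIndepFun ξ μ) (hint : ∀ n, Integrable (ξ n) μ) (hzero : ∀ n, ∫ ω, ξ n ω ∂μ = 0) :
    Martingale (fun n => partialSum ξ (n + 1))
      (Filtration.natural ξ fun n => (hmeas n).stronglyMeasurable) μ := by
  set ℱ := Filtration.natural ξ fun n => (hmeas n).stronglyMeasurable
  have hadp : StronglyAdapted ℱ fun n => partialSum ξ (n + 1) := by
    intro n
    have : partialSum ξ (n + 1) = ∑ i ∈ Finset.range (n + 1), ξ i := by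
      funext ω; simp [partialSum]
    simp only [this]
    refine Finset.stronglyMeasurable_sum _ fun i hi => ?_
    exact (Filtration.stronglyAdapted_natural (fun n => (hmeas n).stronglyMeasurable) i).mono
      (ℱ.mono (Nat.lt_succ_iff.1 (Finset.mem_range.1 hi)))
  have hS : ∀ n, Integrable (partialSum ξ n) μ := fun n =>
    integrable_finsetSum _ fun i _ => hint i
  refine martingale_nat hadp (fun n => hS _) fun n => ?_
  have h1 : partialSum ξ (n + 1 + 1) = partialSum ξ (n + 1) + ξ (n + 1) := by
    funext ω; exact partialSum_succ ξ _ ω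
  have h2 := condExp_add (hS (n + 1)) (hint (n + 1)) (ℱ n)
  have h3 := hindep.condExp_natural_ae_eq_of_lt (fun n => (hmeas n).stronglyMeasurable)
    (Nat.lt_succ_self n)
  rw [h1]
  filter_upwards [h2, h3] with ω h2 h3
  rw [h2, Pi.add_apply, condExp_of_stronglyMeasurable (ℱ.le n) (hadp n) (hS _)]
  have h4 : μ[ξ (n + 1)|ℱ n] ω = 0 := by rw [h3]; exact hzero _
  rw [h4, add_zero]

/-- A centred random walk with steps bounded from above converges where it is bounded above. -/
theorem ae_exists_tendsto_of_bddAbove [IsProbabilityMeasure μ] (hmeas : ∀ n, Measurable (ξ n))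
    (hindep : iIndepFun ξ μ) (hint : ∀ n, Integrable (ξ n) μ) (hzero : ∀ n, ∫ ω, ξ n ω ∂μ = 0)
    {C : ℝ} (hC : ∀ᵐ ω ∂μ, ∀ n, ξ n ω ≤ C) :
    ∀ᵐ ω ∂μ, BddAbove (range fun n => partialSum ξ n ω) →
      ∃ c, Tendsto (fun n => partialSum ξ n ω) atTop (𝓝 c) := by
  set f : ℕ → Ω → ℝ := fun n => partialSum ξ (n + 1)
  have hf := (martingale_partialSum hmeas hindep hint hzero).submartingale
  -- Before it is stopped the walk is below `r`, and the last step overshoots by at most `C`.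
  have hle : ∀ r : ℕ, ∀ i, ∀ᵐ ω ∂μ, stoppedAbove f r i ω ≤ r + C := by
    intro r i
    filter_upwards [hC] with ω hω
    obtain ⟨p, hp, hpe⟩ : ∃ p : ℕ, (p : WithTop ℕ) ≤ leastGE f r ω ∧
        stoppedAbove f r i ω = f p ω := by
      rcases le_total (i : WithTop ℕ) (leastGE f r ω) with h | h
      · exact ⟨i, h, stoppedProcess_eq_of_le h⟩
      · obtain ⟨p, hp⟩ := WithTop.ne_top_iff_exists.1 (ne_top_of_le_ne_top (WithTop.coe_ne_top) h)
        refine ⟨p, hp.le, (stoppedProcess_eq_of_ge h).trans ?_⟩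
        rw [← hp]
        rfl
    rw [hpe]
    cases p with
    | zero =>
      simp only [f, partialSum, zero_add, Finset.sum_range_one]
      have := hω 0
      have hr : (0 : ℝ) ≤ r := r.cast_nonneg
      linarith
    | succ k =>
      have hnot := notMem_of_lt_hittingAfter
        (lt_of_lt_of_le (WithTop.coe_lt_coe.2 (Nat.lt_succ_self k)) hp) bot_le
      rw [Set.mem_Ici, not_le] at hnot
      have h1 : f (k + 1) ω = f k ω + ξ (k + 1) ω := partialSum_succ ξ _ ω
      rw [h1]
      exact add_le_add hnot.le (hω _)
  -- An upper bound together with a nonnegative mean bounds the `L¹` norm, so the stopped walk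
  -- converges; a path bounded by `r` is never stopped.
  have hnorm : ∀ r : ℕ, ∀ i, eLpNorm (stoppedAbove f r i) 1 μ
      ≤ ENNReal.toNNReal (2 * μ Set.univ * ENNReal.ofReal (r + C)) := by
    intro r i
    have h : eLpNorm (stoppedAbove f r i) 1 μ ≤ 2 * μ Set.univ * ENNReal.ofReal (r + C) := by
      refine eLpNorm_one_le_of_le' ((hf.stoppedAbove r).integrable _) ?_ (hle r i)
      rw [← setIntegral_univ]
      refine le_trans ?_ ((hf.stoppedAbove r).setIntegral_le (zero_le (a := i)) MeasurableSet.univ)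
      have h0 : stoppedAbove f r 0 = ξ 0 := by
        funext ω
        simp [stoppedAbove, stoppedProcess, f, partialSum]
      rw [h0, setIntegral_univ, hzero]
    refine h.trans ?_
    simp [ENNReal.coe_toNNReal]
  have ht : ∀ᵐ ω ∂μ, ∀ r : ℕ, ∃ c, Tendsto (fun n => stoppedAbove f r n ω) atTop (𝓝 c) := by
    rw [ae_all_iff]
    exact fun r => Submartingale.exists_ae_tendsto_of_bdd (hf.stoppedAbove r) (hnorm r)
  filter_upwards [ht] with ω hω hωb
  obtain ⟨b, hb⟩ := hωb
  obtain ⟨r, hr⟩ := exists_nat_gt b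
  have hib : ∀ n, f n ω < r := fun n => (hb ⟨n + 1, rfl⟩).trans_lt hr
  obtain ⟨c, hc⟩ := hω r
  refine ⟨c, (tendsto_add_atTop_iff_nat 1).1 (hc.congr fun n => ?_)⟩
  refine stoppedProcess_eq_of_le ?_
  rw [leastGE, hittingAfter_eq_top_iff.mpr (by simp [hib])]
  exact le_top

/-- On a convergent path the steps tend to `0`, but nondegenerate i.i.d. steps exceed a fixed size
infinitely often. -/
theorem ae_not_bddAbove [IsProbabilityMeasure μ] (hmeas : ∀ n, Measurable (ξ n))
    (hindep : iIndepFun ξ μ) (hident : ∀ n, IdentDistrib (ξ n) (ξ 0) μ μ)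
    (hint : Integrable (ξ 0) μ) (hzero : ∫ ω, ξ 0 ω ∂μ = 0)
    {C : ℝ} (hC : ∀ᵐ ω ∂μ, ∀ n, ξ n ω ≤ C) (hnd : ¬ ∀ᵐ ω ∂μ, ξ 0 ω = 0) :
    ∀ᵐ ω ∂μ, ¬ BddAbove (range fun n => partialSum ξ n ω) := by
  have hint' : ∀ n, Integrable (ξ n) μ := fun n => (hident n).integrable_iff.2 hint
  have hzero' : ∀ n, ∫ ω, ξ n ω ∂μ = 0 := fun n => (hident n).integral_eq.trans hzero
  obtain ⟨k, hk⟩ : ∃ k : ℕ, μ (ξ 0 ⁻¹' {x | 1 / ((k : ℝ) + 1) < |x|}) ≠ 0 := by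
    by_contra! hcon
    refine hnd ?_
    filter_upwards [ae_all_iff.2 fun k => (measure_eq_zero_iff_ae_notMem.1 (hcon k))] with ω hω
    by_contra hne
    obtain ⟨k, hk⟩ := exists_nat_one_div_lt (abs_pos.2 hne)
    exact hω k hk
  have hA : MeasurableSet {x : ℝ | 1 / ((k : ℝ) + 1) < |x|} :=
    measurableSet_lt measurable_const (by fun_prop)
  filter_upwards [ae_exists_tendsto_of_bddAbove hmeas hindep hint' hzero' hC,
    ae_frequently_run hmeas hindep hident hA hk 1] with ω h1 h2 hb
  obtain ⟨c, hc⟩ := h1 hb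
  have h3 : Tendsto (fun n => ξ n ω) atTop (𝓝 0) := by
    have := ((tendsto_add_atTop_iff_nat 1).2 hc).sub hc
    rw [sub_self] at this
    refine this.congr fun n => ?_
    rw [partialSum_succ, add_sub_cancel_left]
  have h4 := h3.abs
  rw [abs_zero] at h4
  obtain ⟨n, hn, hn'⟩ := (h2.and_eventually
    (h4.eventually_lt_const (show 0 < 1 / ((k : ℝ) + 1) by positivity))).exists
  have := hn 0 one_pos
  simp only [mul_one, add_zero] at this
  exact absurd this (not_lt.2 hn'.le)

theorem measurableSet_escapeSet (hmeas : ∀ n, Measurable (ξ n)) (δ : ℝ) (k : ℕ) :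
    MeasurableSet (escapeSet ξ δ k) := by
  have : escapeSet ξ δ k = ⋂ m, {ω | δ < ∑ i ∈ Finset.range (m + 1), ξ (k + i) ω} := by
    ext ω; simp [escapeSet]
  rw [this]
  exact MeasurableSet.iInter fun m => measurableSet_lt measurable_const (by fun_prop)

theorem measure_escapeSet [IsProbabilityMeasure μ] (hmeas : ∀ n, Measurable (ξ n))
    (hindep : iIndepFun ξ μ) (hident : ∀ n, IdentDistrib (ξ n) (ξ 0) μ μ) (δ : ℝ) (k : ℕ) :
    μ (escapeSet ξ δ k) = μ (escapeSet ξ δ 0) := by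
  have hlaw : ∀ k, μ.map (fun ω i => ξ (k + i) ω) = Measure.infinitePi fun _ => μ.map (ξ 0) := by
    intro k
    have h := (hindep.precomp (g := fun i => k + i)
      (add_right_injective k)).map_fun_eq_infinitePi_map fun i => hmeas (k + i)
    rw [h]
    congr 1
    funext i
    exact (hident _).map_eq
  let D : Set (ℕ → ℝ) := ⋂ m, {x | δ < ∑ i ∈ Finset.range (m + 1), x i}
  have hD : MeasurableSet D :=
    MeasurableSet.iInter fun m => measurableSet_lt measurable_const (by fun_prop)
  have hpre : ∀ k, escapeSet ξ δ k = (fun ω i => ξ (k + i) ω) ⁻¹' D := by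
    intro k
    ext ω
    simp [escapeSet, D]
  have hm : ∀ k, Measurable fun ω i => ξ (k + i) ω := fun k =>
    measurable_pi_iff.2 fun i => hmeas _
  rw [hpre, hpre, ← Measure.map_apply (hm _) hD, ← Measure.map_apply (hm _) hD, hlaw, hlaw]

/-- By stationarity the expected proportion of escape times before `n` is the common probability of
the escape sets. By the strong law the increments of a centred walk up to `n` are `o(n)`, so this
proportion tends to `0`. -/
theorem measure_escapeSet_eq_zero [IsProbabilityMeasure μ] (hmeas : ∀ n, Measurable (ξ n))
    (hindep : iIndepFun ξ μ) (hident : ∀ n, IdentDistrib (ξ n) (ξ 0) μ μ)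
    (hint : Integrable (ξ 0) μ) (hzero : ∫ ω, ξ 0 ω ∂μ = 0) {δ : ℝ} (hδ : 0 < δ) (k : ℕ) :
    μ (escapeSet ξ δ k) = 0 := by
  classical
  rw [measure_escapeSet hmeas hindep hident]
  let F : ℕ → Ω → ℝ := fun n ω =>
    (∑ k ∈ Finset.range n, (escapeSet ξ δ k).indicator (fun _ => (1 : ℝ)) ω) / n
  have hcard : ∀ n ω, ∑ k ∈ Finset.range n, (escapeSet ξ δ k).indicator (fun _ => (1 : ℝ)) ω
      = ((Finset.range n).filter fun k => ω ∈ escapeSet ξ δ k).card := by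
    intro n ω
    rw [Finset.card_filter]
    push_cast
    exact Finset.sum_congr rfl fun k _ => by rw [Set.indicator_apply]
  have hFmeas : ∀ n, Measurable (F n) := fun n =>
    (Finset.measurable_sum _ fun k _ =>
      measurable_const.indicator (measurableSet_escapeSet hmeas δ k)).div_const _
  have hF0 : ∀ n ω, 0 ≤ F n ω := fun n ω => by
    simp only [F, hcard]; positivity
  have hF1 : ∀ n ω, F n ω ≤ 1 := fun n ω => by
    simp only [F, hcard]
    refine div_le_one_of_le₀ ?_ n.cast_nonneg
    have := Finset.card_filter_le (Finset.range n) fun k => ω ∈ escapeSet ξ δ k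
    rw [Finset.card_range] at this
    exact_mod_cast this
  have hlim : ∀ᵐ ω ∂μ, Tendsto (fun n => F n ω) atTop (𝓝 0) := by
    filter_upwards [ae_tendsto_partialSum_div hint hindep hident] with ω hω
    rw [hzero] at hω
    rw [tendsto_order]
    refine ⟨fun a ha => Eventually.of_forall fun n => ha.trans_le (hF0 n ω), fun a ha => ?_⟩
    -- The bounds on `S_n` and `-S_j` cost `a * δ / 4 * n` each; the other half of `a * δ * n`
    -- absorbs the constant `b' - b`.
    have hε : 0 < a * δ / 4 := by positivity
    obtain ⟨b, hb⟩ := exists_linear_le hω (neg_lt_zero.2 hε)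
    obtain ⟨b', hb'⟩ := exists_le_linear hω hε
    obtain ⟨N, hN⟩ := exists_nat_gt (2 * (b' - b) / (a * δ))
    filter_upwards [eventually_gt_atTop N] with n hn
    have hn0 : (0 : ℝ) < n := by exact_mod_cast (Nat.zero_le _).trans_lt hn
    have hNn : (N : ℝ) ≤ n := by exact_mod_cast hn.le
    simp only [F, hcard]
    rw [div_lt_iff₀ hn0]
    obtain ⟨j, hj, h⟩ := exists_card_escape_le (ξ := ξ) (δ := δ) ω n
    rw [div_lt_iff₀ (by positivity)] at hN
    have h1 := hb j
    have h2 := hb' n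
    have h3 : (j : ℝ) ≤ n := by exact_mod_cast hj
    have h4 : a * δ / 4 * j ≤ a * δ / 4 * n := mul_le_mul_of_nonneg_left h3 hε.le
    have h5 : (N : ℝ) * (a * δ) ≤ n * (a * δ) := mul_le_mul_of_nonneg_right hNn (by positivity)
    refine lt_of_mul_lt_mul_left (h.trans_lt ?_) hδ.le
    linarith
  have hdct := tendsto_integral_of_dominated_convergence (fun _ => (1 : ℝ))
    (fun n => (hFmeas n).aestronglyMeasurable) (integrable_const _)
    (fun n => Eventually.of_forall fun ω => by
      rw [Real.norm_of_nonneg (hF0 n ω)]; exact hF1 n ω) hlim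
  rw [integral_zero] at hdct
  have hval : ∀ᶠ n : ℕ in atTop, ∫ ω, F n ω ∂μ = μ.real (escapeSet ξ δ 0) := by
    filter_upwards [eventually_gt_atTop 0] with n hn
    have hn0 : (n : ℝ) ≠ 0 := by exact_mod_cast hn.ne'
    simp only [F]
    rw [integral_div, integral_finsetSum _ fun k _ =>
      (integrable_const _).indicator (measurableSet_escapeSet hmeas δ k)]
    have h : ∀ k, ∫ ω, (escapeSet ξ δ k).indicator (fun _ => (1 : ℝ)) ω ∂μ
        = μ.real (escapeSet ξ δ 0) := by
      intro k
      rw [integral_indicator_const _ (measurableSet_escapeSet hmeas δ k), smul_eq_mul, mul_one,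
        measureReal_def, measure_escapeSet hmeas hindep hident, measureReal_def]
    simp only [h, Finset.sum_const, Finset.card_range, nsmul_eq_mul]
    field_simp
  have := tendsto_nhds_unique (hdct.congr' hval) tendsto_const_nhds
  exact (measureReal_eq_zero_iff).1 this.symm

/-- A centred random walk does not drift to infinity. -/
theorem ae_not_tendsto_atTop [IsProbabilityMeasure μ] (hmeas : ∀ n, Measurable (ξ n))
    (hindep : iIndepFun ξ μ) (hident : ∀ n, IdentDistrib (ξ n) (ξ 0) μ μ)
    (hint : Integrable (ξ 0) μ) (hzero : ∫ ω, ξ 0 ω ∂μ = 0) :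
    ∀ᵐ ω ∂μ, ¬ Tendsto (fun n => partialSum ξ n ω) atTop atTop := by
  have h : ∀ᵐ ω ∂μ, ∀ q k : ℕ, ω ∉ escapeSet ξ ((1 / 2) ^ q) k := by
    rw [ae_all_iff]
    intro q
    rw [ae_all_iff]
    exact fun k => measure_eq_zero_iff_ae_notMem.1
      (measure_escapeSet_eq_zero hmeas hindep hident hint hzero (by positivity) k)
  filter_upwards [h] with ω hω ht
  -- A diverging walk attains a minimum, but perhaps not strictly. Adding `(1 / 2) ^ n` repairs
  -- this: at a minimiser `k` of the perturbed walk, all later positions exceed `S_k` by at least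
  -- `(1 / 2) ^ (k + 1)`, so `k` is an escape time for `(1 / 2) ^ (k + 2)`.
  have ht' : Tendsto (fun n => partialSum ξ n ω + (1 / 2 : ℝ) ^ n) cofinite atTop := by
    rw [Nat.cofinite_eq_atTop]
    exact tendsto_atTop_mono (fun n => le_add_of_nonneg_right (by positivity)) ht
  obtain ⟨k, hk⟩ := ht'.exists_forall_le
  refine hω (k + 2) k fun m => ?_
  have h1 := hk (k + (m + 1))
  rw [partialSum, partialSum, Finset.sum_range_add] at h1
  have h2 : (1 / 2 : ℝ) ^ (k + (m + 1)) ≤ (1 / 2) ^ (k + 1) :=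
    pow_le_pow_of_le_one (by norm_num) (by norm_num) (by omega)
  have h3 : (0 : ℝ) < (1 / 2) ^ k := by positivity
  rw [pow_succ (1 / 2 : ℝ) k] at h2
  rw [pow_add (1 / 2 : ℝ) k 2]
  linarith

end Probability

/-! ### From random weights to the random walk of their logarithms. -/

section Random

variable {Ω : Type*}

theorem weightProd_eq_exp {X : ℕ → Ω → ℝ} {ω : Ω} (hpos : ∀ n, 0 < X n ω) (n : ℕ) :
    weightProd (fun n => X n ω) n
      = Real.exp (partialSum (fun n ω => Real.log (X n ω)) n ω) := by
  rw [partialSum, Real.exp_sum]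
  exact Finset.prod_congr rfl fun i _ => (Real.exp_log (hpos i)).symm

theorem bddAbove_weightProd_iff {X : ℕ → Ω → ℝ} {ω : Ω} (hpos : ∀ n, 0 < X n ω) :
    BddAbove (range (weightProd fun n => X n ω)) ↔
      BddAbove (range fun n => partialSum (fun n ω => Real.log (X n ω)) n ω) := by
  constructor
  · rintro ⟨K, hK⟩
    refine ⟨Real.log K, ?_⟩
    rintro _ ⟨n, rfl⟩
    have h := hK ⟨n, rfl⟩
    rw [weightProd_eq_exp hpos] at h
    exact (Real.le_log_iff_exp_le ((Real.exp_pos _).trans_le h)).2 h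
  · rintro ⟨K, hK⟩
    refine ⟨Real.exp K, ?_⟩
    rintro _ ⟨n, rfl⟩
    rw [weightProd_eq_exp hpos]
    exact Real.exp_le_exp.2 (hK ⟨n, rfl⟩)

theorem tendsto_weightProd_iff {X : ℕ → Ω → ℝ} {ω : Ω} (hpos : ∀ n, 0 < X n ω) :
    Tendsto (weightProd fun n => X n ω) atTop atTop ↔
      Tendsto (fun n => partialSum (fun n ω => Real.log (X n ω)) n ω) atTop atTop := by
  rw [show (weightProd fun n => X n ω)
    = fun n => Real.exp (partialSum (fun n ω => Real.log (X n ω)) n ω) from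
    funext (weightProd_eq_exp hpos)]
  exact Real.tendsto_exp_comp_atTop

variable [MeasurableSpace Ω] {μ : Measure Ω}

/-- Each point outside the essential range has a null neighbourhood, and in `ℝ` a locally null set
is null. -/
theorem ae_mem_essRange {Y : Ω → ℝ} (hY : Measurable Y) : ∀ᵐ ω ∂μ, Y ω ∈ essRange Y μ := by
  have h : μ.map Y (essRange Y μ)ᶜ = 0 := by
    refine measure_null_of_locally_null _ fun t ht => ?_
    have ht' : ∃ ε : ℝ, 0 < ε ∧ μ {ω | |Y ω - t| < ε} = 0 := by
      by_contra! hcon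
      exact ht fun ε hε => pos_iff_ne_zero.2 (hcon ε hε)
    obtain ⟨ε, hε, h0⟩ := ht'
    refine ⟨Metric.ball t ε, mem_nhdsWithin_of_mem_nhds (Metric.ball_mem_nhds t hε), ?_⟩
    rw [Measure.map_apply hY Metric.isOpen_ball.measurableSet]
    exact h0
  exact ae_of_ae_map hY.aemeasurable (measure_eq_zero_iff_ae_notMem.1 h |>.mono fun x hx =>
    not_not.1 hx)

theorem integrable_of_eExpectation_nonneg {Y : Ω → ℝ} (hY : Measurable Y)
    (hpos : ∫⁻ ω, ENNReal.ofReal (Y ω) ∂μ ≠ ∞) (h : 0 ≤ eExpectation Y μ) : Integrable Y μ := by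
  refine integrable_of_lintegral_ne_top hY hpos fun hneg => ?_
  rw [eExpectation, hneg, EReal.coe_ennreal_top, EReal.sub_top] at h
  exact absurd h (by simp)

end Random

end RandomShift

end

/-- The weights are indexed from `0`, so `X 0` is the first one. Probability one is `∀ᵐ ω, P ω`
and probability zero is `∀ᵐ ω, ¬ P ω`; each implies that the event is null measurable. -/
theorem theorem9p1 {Ω : Type*} [MeasurableSpace Ω] (μ : Measure Ω) [IsProbabilityMeasure μ]
    {H : Type*} [NormedAddCommGroup H] [InnerProductSpace ℂ H] [CompleteSpace H]
    (e : HilbertBasis ℕ ℂ H) (X : ℕ → Ω → ℝ)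
    (hmeas : ∀ n, Measurable (X n))
    (hindep : iIndepFun X μ)
    (hident : ∀ n, IdentDistrib (X n) (X 0) μ μ)
    (hnonneg : ∀ᵐ ω ∂μ, 0 ≤ X 0 ω)
    (hbdd : ∃ C : ℝ, ∀ᵐ ω ∂μ, X 0 ω ≤ C)
    (hnondeg : (essRange (X 0) μ).Nontrivial)
    (hzero : μ {ω | X 0 ω = 0} = 0) :
    -- supercyclicity
    (∀ᵐ ω ∂μ, IsSupercyclic (ContinuousLinearMap.adjoint (randomShift e X ω))) ∧
    -- hypercyclicity
    ((0 ≤ eExpectation (fun ω => Real.log (X 0 ω)) μ →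
        ∀ᵐ ω ∂μ, IsHypercyclic (ContinuousLinearMap.adjoint (randomShift e X ω))) ∧
      (eExpectation (fun ω => Real.log (X 0 ω)) μ < 0 →
        ∀ᵐ ω ∂μ, ¬ IsHypercyclic (ContinuousLinearMap.adjoint (randomShift e X ω)))) ∧
    -- Li–Yorke chaos
    ((1 < essMax (X 0) μ →
        ∀ᵐ ω ∂μ, IsLiYorkeChaotic (ContinuousLinearMap.adjoint (randomShift e X ω))) ∧
      (essMax (X 0) μ ≤ 1 →
        ∀ᵐ ω ∂μ, ¬ IsLiYorkeChaotic (ContinuousLinearMap.adjoint (randomShift e X ω)))) ∧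
    -- topological mixing
    ((0 < eExpectation (fun ω => Real.log (X 0 ω)) μ →
        ∀ᵐ ω ∂μ, IsTopologicallyMixing (ContinuousLinearMap.adjoint (randomShift e X ω))) ∧
      (eExpectation (fun ω => Real.log (X 0 ω)) μ ≤ 0 →
        ∀ᵐ ω ∂μ, ¬ IsTopologicallyMixing (ContinuousLinearMap.adjoint (randomShift e X ω)))) ∧
    -- chaos and frequent hypercyclicity
    ((0 < eExpectation (fun ω => Real.log (X 0 ω)) μ →
        (∀ᵐ ω ∂μ, IsChaotic (ContinuousLinearMap.adjoint (randomShift e X ω))) ∧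
        (∀ᵐ ω ∂μ, IsFrequentlyHypercyclic (ContinuousLinearMap.adjoint (randomShift e X ω)))) ∧
      (eExpectation (fun ω => Real.log (X 0 ω)) μ ≤ 0 →
        (∀ᵐ ω ∂μ, ¬ IsChaotic (ContinuousLinearMap.adjoint (randomShift e X ω))) ∧
        (∀ᵐ ω ∂μ,
          ¬ IsFrequentlyHypercyclic (ContinuousLinearMap.adjoint (randomShift e X ω))))) := by
  obtain ⟨C, hC⟩ := hbdd
  have hpos0 : ∀ᵐ ω ∂μ, 0 < X 0 ω := by
    filter_upwards [hnonneg, measure_eq_zero_iff_ae_notMem.1 hzero] with ω h1 h2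
    exact lt_of_le_of_ne h1 fun h => h2 h.symm
  have hpos : ∀ᵐ ω ∂μ, ∀ n, 0 < X n ω :=
    ae_all_iff.2 fun n => (hident n).symm.ae_snd measurableSet_Ioi hpos0
  have hCn : ∀ᵐ ω ∂μ, ∀ n, X n ω ≤ C :=
    ae_all_iff.2 fun n => (hident n).symm.ae_snd measurableSet_Iic hC
  -- Almost surely one bound holds for all weights, so `weightedShift` does not take its default
  -- value `0`.
  have hshift : ∀ᵐ ω ∂μ, IsBackwardShift e (fun n => X n ω)
      (ContinuousLinearMap.adjoint (randomShift e X ω)) := by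
    filter_upwards [hpos, hCn] with ω h1 h2
    exact isBackwardShift_adjoint e ⟨C, fun n => abs_le.2 ⟨by linarith [h1 n, h2 n], h2 n⟩⟩
  set ξ : ℕ → Ω → ℝ := fun n ω => Real.log (X n ω) with hξ
  have hξm : ∀ n, Measurable (ξ n) := fun n => (hmeas n).log
  have hξindep : iIndepFun ξ μ := hindep.comp (fun _ => Real.log) fun _ => Real.measurable_log
  have hξident : ∀ n, IdentDistrib (ξ n) (ξ 0) μ μ := fun n =>
    (hident n).comp Real.measurable_log
  have hξC : ∀ᵐ ω ∂μ, ∀ n, ξ n ω ≤ Real.log C := by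
    filter_upwards [hpos, hCn] with ω h1 h2 n
    exact Real.log_le_log (h1 n) (h2 n)
  have hξpos : ∫⁻ ω, ENNReal.ofReal (ξ 0 ω) ∂μ ≠ ∞ := by
    refine ne_top_of_le_ne_top ?_ (lintegral_mono_ae (g := fun _ => ENNReal.ofReal (Real.log C))
      (hξC.mono fun ω h => ENNReal.ofReal_le_ofReal (h 0)))
    rw [lintegral_const, measure_univ, mul_one]
    exact ENNReal.ofReal_ne_top
  -- Steps vanishing almost surely would reduce the essential range to `{1}`; excluding this matters
  -- for unboundedness in the centred case.
  have hξnd : ¬ ∀ᵐ ω ∂μ, ξ 0 ω = 0 := by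
    intro h
    have h1 : ∀ᵐ ω ∂μ, X 0 ω = 1 := by
      filter_upwards [h, hpos0] with ω h h0
      exact Real.eq_one_of_pos_of_log_eq_zero h0 h
    refine Set.not_subsingleton_iff.2 hnondeg (Set.subsingleton_of_subset_singleton (a := 1) ?_)
    intro t ht
    by_contra hne
    refine (ht |1 - t| (abs_pos.2 (sub_ne_zero.2 (Ne.symm hne)))).ne' ?_
    refine measure_eq_zero_iff_ae_notMem.2 (h1.mono fun ω h => ?_)
    simp [h]
  have hR := isGreatest_essMax hnondeg.nonempty ⟨C, hC⟩
  have hgrow : 0 < eExpectation (ξ 0) μ → ∀ᵐ ω ∂μ, ∃ c ρ : ℝ, 0 < c ∧ 0 < ρ ∧ ρ < 1 ∧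
      ∀ n, c * (ρ⁻¹) ^ n ≤ weightProd (fun n => X n ω) n := by
    intro hE
    have hint := integrable_of_eExpectation_nonneg (hξm 0) hξpos hE.le
    rw [eExpectation_eq_integral hint] at hE
    have hE' : 0 < ∫ ω, ξ 0 ω ∂μ := by exact_mod_cast hE
    filter_upwards [hpos, ae_tendsto_partialSum_div hint hξindep hξident] with ω h0 hω
    -- Any rate `a` strictly between `0` and the mean works, with `ρ = exp (-a)`.
    obtain ⟨a, ha0, ha⟩ := exists_between hE'
    obtain ⟨b, hb⟩ := exists_linear_le hω ha
    refine ⟨Real.exp b, Real.exp (-a), Real.exp_pos _, Real.exp_pos _,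
      Real.exp_lt_one_iff.2 (by linarith), fun n => ?_⟩
    rw [weightProd_eq_exp h0, ← Real.exp_neg, neg_neg, ← Real.exp_nat_mul, ← Real.exp_add]
    exact Real.exp_le_exp.2 (by linarith [hb n])
  have htend : 0 < eExpectation (ξ 0) μ →
      ∀ᵐ ω ∂μ, Tendsto (weightProd fun n => X n ω) atTop atTop := by
    intro hE
    filter_upwards [hgrow hE] with ω ⟨c, ρ, hc, hρ, hρ1, h⟩
    exact tendsto_atTop_mono h
      ((tendsto_pow_atTop_atTop_of_one_lt ((one_lt_inv₀ hρ).2 hρ1)).const_mul_atTop hc)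
  have hbound : eExpectation (ξ 0) μ < 0 →
      ∀ᵐ ω ∂μ, BddAbove (range (weightProd fun n => X n ω)) := by
    intro hE
    filter_upwards [hpos, ae_bddAbove_of_eExpectation_neg hξm hξindep hξident hξpos hE]
      with ω h0 h
    exact (bddAbove_weightProd_iff h0).2 h
  have hcentred : eExpectation (ξ 0) μ = 0 → Integrable (ξ 0) μ ∧ ∫ ω, ξ 0 ω ∂μ = 0 := by
    intro hE
    have hint := integrable_of_eExpectation_nonneg (hξm 0) hξpos hE.ge
    rw [eExpectation_eq_integral hint] at hE
    exact ⟨hint, by exact_mod_cast hE⟩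
  have hunbdd : 0 ≤ eExpectation (ξ 0) μ →
      ∀ᵐ ω ∂μ, ¬ BddAbove (range (weightProd fun n => X n ω)) := by
    intro hE
    rcases hE.eq_or_lt with hE | hE
    · obtain ⟨hint, hz⟩ := hcentred hE.symm
      filter_upwards [hpos, ae_not_bddAbove hξm hξindep hξident hint hz hξC hξnd] with ω h0 h
      rwa [bddAbove_weightProd_iff h0]
    · filter_upwards [htend hE] with ω h
      exact not_bddAbove_of_tendsto_atTop h
  have hntend : eExpectation (ξ 0) μ ≤ 0 →
      ∀ᵐ ω ∂μ, ¬ Tendsto (weightProd fun n => X n ω) atTop atTop := by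
    intro hE
    rcases hE.eq_or_lt with hE | hE
    · obtain ⟨hint, hz⟩ := hcentred hE
      filter_upwards [hpos, ae_not_tendsto_atTop hξm hξindep hξident hint hz] with ω h0 h
      rwa [tendsto_weightProd_iff h0]
    · filter_upwards [hbound hE] with ω h h'
      exact not_bddAbove_of_tendsto_atTop h' h
  refine ⟨?_, ⟨fun hE => ?_, fun hE => ?_⟩, ⟨fun hR1 => ?_, fun hR1 => ?_⟩,
    ⟨fun hE => ?_, fun hE => ?_⟩, ⟨fun hE => ⟨?_, ?_⟩, fun hE => ⟨?_, ?_⟩⟩⟩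
  · filter_upwards [hpos, hshift] with ω h0 hB
    exact hB.isSupercyclic h0
  · filter_upwards [hpos, hCn, hshift, hunbdd hE] with ω h0 h1 hB h
    exact hB.isHypercyclic h0 h1 h
  · filter_upwards [hpos, hshift, hbound hE] with ω h0 hB h
    exact hB.not_isHypercyclic h0 h
  · obtain ⟨r, hr1, hr⟩ := exists_between hR1
    have hA : μ (X 0 ⁻¹' Set.Ici r) ≠ 0 := by
      refine ((hR.1 (essMax (X 0) μ - r) (by linarith)).trans_le (measure_mono fun ω hω => ?_)).ne'
      have h := (abs_lt.1 (show |X 0 ω - essMax (X 0) μ| < essMax (X 0) μ - r from hω)).1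
      change r ≤ X 0 ω
      linarith
    filter_upwards [hpos, hshift, ae_all_iff.2 fun L =>
      ae_frequently_run hmeas hindep hident measurableSet_Ici hA L] with ω h0 hB h
    refine hB.isLiYorkeChaotic h0 hr1 fun L => ?_
    obtain ⟨j, hj⟩ := (h L).exists
    exact ⟨j * L, hj⟩
  · have hle : ∀ᵐ ω ∂μ, X 0 ω ≤ 1 := by
      filter_upwards [ae_mem_essRange (μ := μ) (hmeas 0)] with ω h
      exact (hR.2 h).trans hR1
    have hle' : ∀ᵐ ω ∂μ, ∀ n, X n ω ≤ 1 :=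
      ae_all_iff.2 fun n => (hident n).symm.ae_snd measurableSet_Iic hle
    filter_upwards [hpos, hshift, hle'] with ω h0 hB h
    exact not_isLiYorkeChaotic_of_norm_le
      (hB.norm_apply_le fun n => abs_le.2 ⟨by linarith [h0 n], h n⟩)
  · filter_upwards [hpos, hshift, htend hE] with ω h0 hB h
    exact hB.isTopologicallyMixing h0 h
  · filter_upwards [hpos, hshift, hntend hE] with ω h0 hB h
    exact hB.not_isTopologicallyMixing h0 h
  · filter_upwards [hpos, hshift, hgrow hE] with ω h0 hB ⟨c, ρ, hc, hρ, hρ1, h⟩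
    exact hB.isChaotic h0 hc hρ hρ1 h
  · filter_upwards [hpos, hshift, hgrow hE] with ω h0 hB ⟨c, ρ, hc, hρ, hρ1, h⟩
    exact hB.isFrequentlyHypercyclic h0 hc hρ hρ1 h
  · filter_upwards [hpos, hCn, hshift, hntend hE] with ω h0 h1 hB h
    exact hB.not_isChaotic h0 h1 h
  · filter_upwards [hpos, hCn, hshift, hntend hE] with ω h0 h1 hB h
    exact hB.not_isFrequentlyHypercyclic h0 h1 h
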